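/- **Setting.** Formulas are built from countably many atoms with $\top,\bot,\wedge,\vee,\to$, and $\neg\phi$ abbreviates $\phi\to\bot$. $\mathbf{LK}^-$ is the cut-free classical sequent calculus on sequents $\Gamma\Rightarrow\Delta$ (finite sequences of formulas): axioms $\phi\Rightarrow\phi$, $\bot\Rightarrow$, $\Rightarrow\top$; exchange, weakening and contraction on both sides; the usual left and right rules for $\wedge,\vee,\to$. An $\mathbf{LK}^-$-proof of $\phi$ is a finite sequence of sequents ending in $\Rightarrow\phi$, each an axiom or inferred by a rule from earlier ones. A clause is a finite sequence of literals read as their disjunction. A resolution refutation of a finite sequence $\mathcal C$ of clauses is a finite sequence of clauses ending in the empty clause, each a member of $\mathcal C$ or obtained (as a set of literals) as $C\cup D$ from earlier clauses $C\cup\{x\}$ and $D\cup\{\neg x\}$. Formulas, sequences of clauses, proofs and refutations are encoded by binary strings in a standard way, and the size of an object is the length of its code. A proof system for a language $L\subseteq\{0,1\}^*$ is p-bounded if there is a polynomial $p$ such that every $w\in L$ has a proof of length at most $p(|w|)$. Here $\mathbf{LK}^-$ is considered as a proof system for the set of classically valid formulas, and resolution $\mathbf R$ as a proof system for the set of unsatisfiable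 finite sequences of clauses. For $0<\varepsilon<1/3$ and $n\in\mathbb N$ put $k=\lfloor n^{2/3}\rfloor$ and $l=\lfloor n^{2/3-2\varepsilon}\rfloor$, and use atoms $p_{ij}$ (one for each two-element set $\{i,j\}\subseteq\{1,\dots,n\}$), $q_{ui}$ ($u\le k$, $i\le n$) and $r_{ia}$ ($i\le n$, $a\le l$). $\mathrm{Clique}^\varepsilon_n(\bar p,\bar q)$ consists of the clauses - $\bigvee_{i\le n}q_{ui}$ for $u\le k$; - $\neg q_{ui_1}\vee\neg q_{ui_2}$ for $u\le k$, $i_1\ne i_2\le n$; - $\neg q_{u_1i}\vee\neg q_{u_2i}$ for $u_1\ne u_2\le k$, $i\le n$; - $\neg q_{u_1i_1}\vee\neg q_{u_2i_2}\vee p_{i_1i_2}$ for $u_1\ne u_2\le k$, $i_1< i_2\le n$. $\mathrm{Color}^\varepsilon_n(\bar p,\bar r)$ consists of the clauses - $\bigvee_{a\le l}r_{ia}$ for $i\le n$; - $\neg r_{ia_1}\vee\neg r_{ia_2}$ for $i\le n$, $a_1\ne a_2\le l$; - $\neg r_{i_1a}\vee\neg r_{i_2a}\vee\neg p_{i_1i_2}$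 for $a\le l$, $i_1<i_2\le n$. In $\mathrm{Clique}^\varepsilon_n\to\neg\mathrm{Color}^\varepsilon_n$ each family of clauses stands for the conjunction of its clauses. **Statement.** Let $0<\varepsilon<1/3$. 1. There are $c>0$ and $N$ (depending on $\varepsilon$) such that for all $n\ge N$ every $\mathbf{LK}^-$-proof of $\mathrm{Clique}^\varepsilon_n(\bar p,\bar q)\to\neg\mathrm{Color}^\varepsilon_n(\bar p,\bar r)$ has size at least $2^{c\,n^{1/3-\varepsilon}}$. 2. There are $c>0$ and $N$ (depending on $\varepsilon$) such that for all $n\ge N$ every resolution refutation of $\mathrm{Clique}^\varepsilon_n(\bar p,\bar q)\cup\mathrm{Color}^\varepsilon_n(\bar p,\bar r)$ has size at least $2^{c\,n^{1/3-\varepsilon}}$. Consequently, neither $\mathbf{LK}^-$ nor $\mathbf R$ is p-bounded. -/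

import Mathlib

namespace ProofComplexity

/-! ### Binary codes -/

/-- Code of a finite sequence, given a code for its entries: every entry is announced by
the bit 1 and the end of the sequence is marked by the bit 0. -/
def listCode {α : Type} (c : α → List Bool) (l : List α) : List Bool :=
  l.flatMap (fun x => true :: c x) ++ [false]

/-- Code of a natural number through its binary digits; its length is `2 * log n + O(1)`. -/
def natCode (n : ℕ) : List Bool := listCode (fun b => [b]) n.bits

/-- A code is self-delimiting (hence injective) if a code word can be read off
unambiguously from the front of any string. -/
def SelfDelimiting {α : Type} (c : α → List Bool) : Prop :=
  ∀ (x y : α) (s t : List Bool), c x ++ s = c y ++ t → x = y ∧ s = t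

theorem SelfDelimiting.injective {α : Type} {c : α → List Bool} (h : SelfDelimiting c) :
    Function.Injective c := fun x y hxy => (h x y [] [] (by rw [hxy])).1

theorem SelfDelimiting.list {α : Type} {c : α → List Bool} (h : SelfDelimiting c) :
    SelfDelimiting (listCode c) := by
  intro x
  induction x with
  | nil =>
    intro y s t hst
    cases y with
    | nil => simpa [listCode] using hst
    | cons b y => simp [listCode] at hst
  | cons a x ih =>
    intro y s t hst
    cases y with
    | nil => simp [listCode] at hst
    | cons b y =>
      have h1 : c a ++ (listCode c x ++ s) = c b ++ (listCode c y ++ t) := by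
        simpa [listCode] using hst
      obtain ⟨rfl, h2⟩ := h _ _ _ _ h1
      obtain ⟨rfl, h3⟩ := ih _ _ _ h2
      exact ⟨rfl, h3⟩

theorem natCode_selfDelimiting : SelfDelimiting natCode := by
  intro m n s t h
  have hb : SelfDelimiting (fun b : Bool => [b]) := by
    intro x y s t h
    simpa using h
  obtain ⟨h1, h2⟩ := hb.list _ _ _ _ h
  refine ⟨?_, h2⟩
  apply Nat.eq_of_testBit_eq
  intro i
  rw [Nat.testBit_eq_inth, Nat.testBit_eq_inth, h1]

/-! ### Formulas -/

/-- Propositional formulas in the language `{⊤, ⊥, ∧, ∨, →}`; the atoms are indexed by `ℕ`. -/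
inductive Formula : Type
  | atom (x : ℕ) : Formula
  | top : Formula
  | bot : Formula
  | and (φ ψ : Formula) : Formula
  | or (φ ψ : Formula) : Formula
  | imp (φ ψ : Formula) : Formula

namespace Formula

/-- `¬ φ` abbreviates `φ → ⊥`. -/
def neg (φ : Formula) : Formula := imp φ bot

/-- Truth value under a Boolean assignment. -/
def eval (v : ℕ → Bool) : Formula → Bool
  | atom x => v x
  | top => true
  | bot => false
  | and φ ψ => eval v φ && eval v ψ
  | or φ ψ => eval v φ || eval v ψ
  | imp φ ψ => !eval v φ || eval v ψ

/-- Classical validity. -/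
def Valid (φ : Formula) : Prop := ∀ v : ℕ → Bool, φ.eval v = true

/-- Finite conjunction, bracketed to the right. -/
def conj : List Formula → Formula
  | [] => top
  | [φ] => φ
  | φ :: ψ :: l => and φ (conj (ψ :: l))

/-- Finite disjunction, bracketed to the right. -/
def disj : List Formula → Formula
  | [] => bot
  | [φ] => φ
  | φ :: ψ :: l => or φ (disj (ψ :: l))

/-- Binary code of a formula (prefix notation). -/
def code : Formula → List Bool
  | atom x => [false, false, false] ++ natCode x
  | top => [false, false, true]
  | bot => [false, true, false]
  | and φ ψ => [false, true, true] ++ (code φ ++ code ψ)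
  | or φ ψ => [true, false, false] ++ (code φ ++ code ψ)
  | imp φ ψ => [true, false, true] ++ (code φ ++ code ψ)

theorem code_selfDelimiting : SelfDelimiting code := by
  intro φ
  induction φ with
  | atom x =>
    intro ψ s t h
    cases ψ <;> simp [code] at h ⊢
    exact natCode_selfDelimiting _ _ _ _ h
  | top => intro ψ s t h; cases ψ <;> simp [code] at h ⊢; exact h
  | bot => intro ψ s t h; cases ψ <;> simp [code] at h ⊢; exact h
  | and φ₁ φ₂ ih₁ ih₂ =>
    intro ψ s t h
    cases ψ <;> simp [code] at h ⊢
    obtain ⟨rfl, h1⟩ := ih₁ _ _ _ h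
    obtain ⟨rfl, h2⟩ := ih₂ _ _ _ h1
    simp [h2]
  | or φ₁ φ₂ ih₁ ih₂ =>
    intro ψ s t h
    cases ψ <;> simp [code] at h ⊢
    obtain ⟨rfl, h1⟩ := ih₁ _ _ _ h
    obtain ⟨rfl, h2⟩ := ih₂ _ _ _ h1
    simp [h2]
  | imp φ₁ φ₂ ih₁ ih₂ =>
    intro ψ s t h
    cases ψ <;> simp [code] at h ⊢
    obtain ⟨rfl, h1⟩ := ih₁ _ _ _ h
    obtain ⟨rfl, h2⟩ := ih₂ _ _ _ h1
    simp [h2]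

end Formula

/-! ### The cut-free sequent calculus -/

/-- A sequent `Γ ⇒ Δ`, where `Γ` and `Δ` are finite sequences of formulas. -/
structure Sequent : Type where
  ant : List Formula
  suc : List Formula

/-- Binary code of a sequent. -/
def Sequent.code (S : Sequent) : List Bool :=
  listCode Formula.code S.ant ++ listCode Formula.code S.suc

theorem Sequent.code_selfDelimiting : SelfDelimiting Sequent.code := by
  rintro ⟨a, b⟩ ⟨a', b'⟩ s t h
  simp only [Sequent.code, List.append_assoc] at h
  obtain ⟨rfl, h1⟩ := Formula.code_selfDelimiting.list _ _ _ _ h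
  obtain ⟨rfl, h2⟩ := Formula.code_selfDelimiting.list _ _ _ _ h1
  exact ⟨rfl, h2⟩

open Formula in
/-- `LKStep P S`: the sequent `S` is an axiom of `LK`, or it follows from premises in the
set `P` by one application of a rule of `LK` other than cut. -/
inductive LKStep (P : Set Sequent) : Sequent → Prop
  | ax (φ : Formula) : LKStep P ⟨[φ], [φ]⟩
  | axBot : LKStep P ⟨[bot], []⟩
  | axTop : LKStep P ⟨[], [top]⟩
  | exchangeL (Γ Θ Δ : List Formula) (φ ψ : Formula) :
      ⟨Γ ++ φ :: ψ :: Θ, Δ⟩ ∈ P → LKStep P ⟨Γ ++ ψ :: φ :: Θ, Δ⟩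
  | exchangeR (Γ Δ Λ : List Formula) (φ ψ : Formula) :
      ⟨Γ, Δ ++ φ :: ψ :: Λ⟩ ∈ P → LKStep P ⟨Γ, Δ ++ ψ :: φ :: Λ⟩
  | weakL (Γ Δ : List Formula) (φ : Formula) :
      ⟨Γ, Δ⟩ ∈ P → LKStep P ⟨Γ ++ [φ], Δ⟩
  | weakR (Γ Δ : List Formula) (φ : Formula) :
      ⟨Γ, Δ⟩ ∈ P → LKStep P ⟨Γ, φ :: Δ⟩
  | contrL (Γ Δ : List Formula) (φ : Formula) :
      ⟨Γ ++ [φ, φ], Δ⟩ ∈ P → LKStep P ⟨Γ ++ [φ], Δ⟩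
  | contrR (Γ Δ : List Formula) (φ : Formula) :
      ⟨Γ, φ :: φ :: Δ⟩ ∈ P → LKStep P ⟨Γ, φ :: Δ⟩
  | andL₁ (Γ Δ : List Formula) (φ ψ : Formula) :
      ⟨Γ ++ [φ], Δ⟩ ∈ P → LKStep P ⟨Γ ++ [and φ ψ], Δ⟩
  | andL₂ (Γ Δ : List Formula) (φ ψ : Formula) :
      ⟨Γ ++ [ψ], Δ⟩ ∈ P → LKStep P ⟨Γ ++ [and φ ψ], Δ⟩
  | andR (Γ Δ : List Formula) (φ ψ : Formula) :
      ⟨Γ, φ :: Δ⟩ ∈ P → ⟨Γ, ψ :: Δ⟩ ∈ P → LKStep P ⟨Γ, and φ ψ :: Δ⟩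
  | orL (Γ Δ : List Formula) (φ ψ : Formula) :
      ⟨Γ ++ [φ], Δ⟩ ∈ P → ⟨Γ ++ [ψ], Δ⟩ ∈ P → LKStep P ⟨Γ ++ [or φ ψ], Δ⟩
  | orR₁ (Γ Δ : List Formula) (φ ψ : Formula) :
      ⟨Γ, φ :: Δ⟩ ∈ P → LKStep P ⟨Γ, or φ ψ :: Δ⟩
  | orR₂ (Γ Δ : List Formula) (φ ψ : Formula) :
      ⟨Γ, ψ :: Δ⟩ ∈ P → LKStep P ⟨Γ, or φ ψ :: Δ⟩
  | impL (Γ Δ : List Formula) (φ ψ : Formula) :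
      ⟨Γ, φ :: Δ⟩ ∈ P → ⟨Γ ++ [ψ], Δ⟩ ∈ P → LKStep P ⟨Γ ++ [imp φ ψ], Δ⟩
  | impR (Γ Δ : List Formula) (φ ψ : Formula) :
      ⟨Γ ++ [φ], ψ :: Δ⟩ ∈ P → LKStep P ⟨Γ, imp φ ψ :: Δ⟩

/-- `π` is a cut-free `LK`-proof of the formula `φ`: a sequence of sequents ending in `⇒ φ`,
each of which is an axiom or follows from earlier ones by a rule.  A sequent may be used as
a premise any number of times. -/
def IsCutFreeProof (π : List Sequent) (φ : Formula) : Prop :=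
  (∀ (σ τ : List Sequent) (S : Sequent), π = σ ++ S :: τ → LKStep {T | T ∈ σ} S) ∧
    π.getLast? = some ⟨[], [φ]⟩

/-- Binary code of a sequence of sequents. -/
def lkProofCode (π : List Sequent) : List Bool := listCode Sequent.code π

theorem lkProofCode_selfDelimiting : SelfDelimiting lkProofCode :=
  Sequent.code_selfDelimiting.list

/-! ### Clauses and resolution -/

/-- A literal: an atom or a negated atom. -/
inductive Literal : Type
  | pos (x : ℕ) : Literal
  | neg (x : ℕ) : Literal

namespace Literal

def eval (v : ℕ → Bool) : Literal → Bool
  | pos x => v x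
  | neg x => !v x

def toFormula : Literal → Formula
  | pos x => Formula.atom x
  | neg x => Formula.neg (Formula.atom x)

/-- Binary code of a literal. -/
def code : Literal → List Bool
  | pos x => true :: natCode x
  | neg x => false :: natCode x

theorem code_selfDelimiting : SelfDelimiting code := by
  rintro (x | x) (y | y) s t h <;> simp [code] at h ⊢ <;>
    exact natCode_selfDelimiting _ _ _ _ h

end Literal

/-- A clause is a finite sequence of literals, read as their disjunction. -/
abbrev Clause : Type := List Literal

namespace Clause

/-- The set of literals of a clause. -/
def lits (C : Clause) : Set Literal := {l | l ∈ C}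

/-- The disjunction of the literals of a clause. -/
def toFormula (C : Clause) : Formula := Formula.disj (C.map Literal.toFormula)

/-- The clause is true under the assignment `v`. -/
def Holds (v : ℕ → Bool) (C : Clause) : Prop := ∃ l ∈ C, Literal.eval v l = true

/-- `E` is obtained from `C₁ = C ∪ {x}` and `C₂ = D ∪ {¬ x}` by resolution: `E = C ∪ D`.
Clauses are compared as sets of literals. -/
def IsResolvent (C₁ C₂ E : Clause) : Prop :=
  ∃ (x : ℕ) (C D : Set Literal),
    lits C₁ = C ∪ {Literal.pos x} ∧ lits C₂ = D ∪ {Literal.neg x} ∧ lits E = C ∪ D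

end Clause

/-- The sequence of clauses `𝒞` is unsatisfiable. -/
def Unsat (𝒞 : List Clause) : Prop := ¬ ∃ v : ℕ → Bool, ∀ C ∈ 𝒞, Clause.Holds v C

/-- The conjunction of the clauses in `𝒞`, as a formula. -/
def cnfFormula (𝒞 : List Clause) : Formula := Formula.conj (𝒞.map Clause.toFormula)

/-- `π` is a resolution refutation of `𝒞`: a sequence of clauses ending in the empty clause,
each of which belongs to `𝒞` or is a resolvent of two earlier ones. -/
def IsRefutation (π : List Clause) (𝒞 : List Clause) : Prop :=
  (∀ (σ τ : List Clause) (E : Clause), π = σ ++ E :: τ →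
    E ∈ 𝒞 ∨ ∃ C₁ ∈ σ, ∃ C₂ ∈ σ, Clause.IsResolvent C₁ C₂ E) ∧
    π.getLast? = some []

/-- Binary code of a sequence of clauses. -/
def clausesCode (𝒞 : List Clause) : List Bool := listCode (listCode Literal.code) 𝒞

theorem clausesCode_selfDelimiting : SelfDelimiting clausesCode :=
  Literal.code_selfDelimiting.list.list

/-! ### Proof systems as relations on binary strings -/

/-- The language of (codes of) classically valid formulas. -/
def CPC : Set (List Bool) := {w | ∃ φ : Formula, φ.Valid ∧ w = φ.code}

/-- Cut-free `LK` as a relation "`u` is a proof of `w`" between binary strings. -/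
def LKMinus (u w : List Bool) : Prop :=
  ∃ (π : List Sequent) (φ : Formula), u = lkProofCode π ∧ w = φ.code ∧ IsCutFreeProof π φ

/-- The language of (codes of) unsatisfiable sequences of clauses. -/
def UNSAT : Set (List Bool) := {w | ∃ 𝒞 : List Clause, Unsat 𝒞 ∧ w = clausesCode 𝒞}

/-- Resolution as a relation "`u` is a refutation of `w`" between binary strings. -/
def Resolution (u w : List Bool) : Prop :=
  ∃ (π 𝒞 : List Clause), u = clausesCode π ∧ w = clausesCode 𝒞 ∧ IsRefutation π 𝒞

/-- The proof system `P` for the language `L` is polynomially bounded: every `w ∈ L` has a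
`P`-proof of length polynomial in the length of `w`. -/
def PBounded (L : Set (List Bool)) (P : List Bool → List Bool → Prop) : Prop :=
  ∃ p : Polynomial ℕ, ∀ w ∈ L, ∃ u : List Bool, P u w ∧ u.length ≤ p.eval w.length

/-! ### The clique-coloring clauses -/

/-- The atom `p_{ij}` (used for `i < j` only): `{i, j}` is an edge. -/
def edgeAtom (i j : ℕ) : ℕ := 3 * Nat.pair i j

/-- The atom `q_{ui}`: the `u`-th vertex of the clique is `i`. -/
def cliqueAtom (u i : ℕ) : ℕ := 3 * Nat.pair u i + 1

/-- The atom `r_{ia}`: the vertex `i` has color `a`. -/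
def colorAtom (i a : ℕ) : ℕ := 3 * Nat.pair i a + 2

/-- All ordered pairs of distinct numbers below `m`. -/
def distinctPairs (m : ℕ) : List (ℕ × ℕ) :=
  (List.range m ×ˢ List.range m).filter (fun x => x.1 ≠ x.2)

/-- All two-element subsets of `{0, …, m - 1}`, listed as pairs `(i, j)` with `i < j`. -/
def twoSubsets (m : ℕ) : List (ℕ × ℕ) :=
  (List.range m ×ˢ List.range m).filter (fun x => x.1 < x.2)

open Literal in
/-- The clauses stating that `q` describes a `k`-clique in the graph `p` on `n` vertices. -/
def cliqueClauses (k n : ℕ) : List Clause :=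
  (List.range k).map (fun u => (List.range n).map (fun i => pos (cliqueAtom u i))) ++
  (List.range k ×ˢ distinctPairs n).map
    (fun x => [neg (cliqueAtom x.1 x.2.1), neg (cliqueAtom x.1 x.2.2)]) ++
  (distinctPairs k ×ˢ List.range n).map
    (fun x => [neg (cliqueAtom x.1.1 x.2), neg (cliqueAtom x.1.2 x.2)]) ++
  (distinctPairs k ×ˢ twoSubsets n).map
    (fun x => [neg (cliqueAtom x.1.1 x.2.1), neg (cliqueAtom x.1.2 x.2.2),
      pos (edgeAtom x.2.1 x.2.2)])

open Literal in
/-- The clauses stating that `r` describes an `l`-coloring of the graph `p` on `n` vertices. -/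
def colorClauses (l n : ℕ) : List Clause :=
  (List.range n).map (fun i => (List.range l).map (fun a => pos (colorAtom i a))) ++
  (List.range n ×ˢ distinctPairs l).map
    (fun x => [neg (colorAtom x.1 x.2.1), neg (colorAtom x.1 x.2.2)]) ++
  (List.range l ×ˢ twoSubsets n).map
    (fun x => [neg (colorAtom x.2.1 x.1), neg (colorAtom x.2.2 x.1),
      neg (edgeAtom x.2.1 x.2.2)])

/-- The clauses `Clique^ε_n` (they do not depend on `ε`): the clique has `⌊n ^ (2/3)⌋` vertices. -/
noncomputable def Clique (n : ℕ) : List Clause :=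
  cliqueClauses ⌊(n : ℝ) ^ (2 / 3 : ℝ)⌋₊ n

/-- The clauses `Color^ε_n`: there are `⌊n ^ (2/3 - 2ε)⌋` colors. -/
noncomputable def Color (ε : ℝ) (n : ℕ) : List Clause :=
  colorClauses ⌊(n : ℝ) ^ (2 / 3 - 2 * ε : ℝ)⌋₊ n

/-- The formula `Clique^ε_n → ¬ Color^ε_n`. -/
noncomputable def cliqueColorFormula (ε : ℝ) (n : ℕ) : Formula :=
  Formula.imp (cnfFormula (Clique n)) (Formula.neg (cnfFormula (Color ε n)))

end ProofComplexity

open ProofComplexity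

/-! The proof is monotone feasible interpolation merged with the approximation method, applied to
the lines of a proof without first extracting a circuit.

Split `k * m` of the vertices into `k` blocks of size `m`. A test input is a transversal `a` of the
blocks, which yields a clique, or an `l`-coloring `b`, which yields a complete multipartite graph.
Each line of a proof gets the rectangle `A × B` of the `a` falsifying its clique part and the `b`
falsifying its coloring part; an edge literal belongs to the clique part if positive and to the
coloring part if negated. The last line gets the full rectangle. Initial lines get rectangles with
an empty side, or lying in an edge rectangle (transversals through two given vertices, colorings
giving these the same color). A step derives its rectangle by weakening, or by at most two gates,
each a union on one side and an intersection on the other (`covers_lkStep`, `covers_resolvent`). For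
the sequent calculus, the subformula property confines attention to `Relevant` sequents.

For the lower bound, a rectangle is approximated by a family `𝒟` of sets of at most `s` vertices and
a family `𝒞` of idempotent maps moving at most `s` vertices, where every map identifies two points
of every set. By branching, an intersection of sets of transversals loses at most a fraction
`(2s/m)^(s+1)` of the transversals (`Approx.and`), and an intersection of sets of colorings at most
a fraction `(s²/l)^(s+1)` of the colorings (`Approx.or`). The full rectangle forces the loss of all
transversals or of half the colorings (`Approx.large_error`). For `4s ≤ m` and `2s² ≤ l` this takes
at least `2^s` gates (`Covers.two_pow_le`), and `s` can be taken close to `n^(1/3-ε)/8`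
(`parameters`).

Failure of p-boundedness follows with `ε = 1/6`: the instances have codes of length `O(n^7)`, and
are valid or unsatisfiable by the pigeonhole principle. -/

namespace ProofComplexity

set_option linter.unusedSectionVars false

/-! ### Branching arguments -/

/-- If every partial object of level `r < d` branches into at most `M` partial objects of level
`r + 1` that capture all bad points below it, then there are few bad points. -/
theorem card_mul_le_of_branching {P X : Type*} [DecidableEq X] (sub : P → X → Prop)
    (level : ℕ → P → Prop) (bad : Finset X) (M c T d : ℕ)
    (hcount : ∀ p, level d p → ∀ E : Finset X, (∀ x ∈ E, sub p x) → E.card * c ≤ T)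
    (hbranch : ∀ r p, r < d → level r p → ∃ next : Finset P, next.card ≤ M ∧
      (∀ p' ∈ next, level (r + 1) p') ∧ ∀ x ∈ bad, sub p x → ∃ p' ∈ next, sub p' x)
    (p₀ : P) (h₀ : level 0 p₀) (hsub : ∀ x, sub p₀ x) : bad.card * c ≤ M ^ d * T := by
  classical
  -- With `j` levels left, the branching tree has at most `M ^ j` leaves, and each leaf captures a
  -- set `E` with `E.card * c ≤ T`.
  have key : ∀ j r p, r + j = d → level r p → ∀ E ⊆ bad, (∀ x ∈ E, sub p x) →
      E.card * c ≤ M ^ j * T := by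
    intro j
    induction j with
    | zero =>
      intro r p hr hp E _ hE
      obtain rfl : r = d := by omega
      simpa using hcount p hp E hE
    | succ j ih =>
      intro r p hr hp E hbad hE
      obtain ⟨next, hM, hlev, hnext⟩ := hbranch r p (by omega) hp
      have hsubset : E ⊆ next.biUnion fun p' => E.filter (sub p') := by
        intro x hx
        obtain ⟨p', hp', hx'⟩ := hnext x (hbad hx) (hE x hx)
        simp only [Finset.mem_biUnion, Finset.mem_filter]
        exact ⟨p', hp', hx, hx'⟩
      calc E.card * c ≤ (∑ p' ∈ next, (E.filter (sub p')).card) * c :=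
            Nat.mul_le_mul_right _ ((Finset.card_le_card hsubset).trans Finset.card_biUnion_le)
        _ = ∑ p' ∈ next, (E.filter (sub p')).card * c := Finset.sum_mul _ _ _
        _ ≤ ∑ _p' ∈ next, M ^ j * T := Finset.sum_le_sum fun p' hp' =>
            ih (r + 1) p' (by omega) (hlev p' hp') _ ((Finset.filter_subset _ _).trans hbad)
              (fun x hx => (Finset.mem_filter.1 hx).2)
        _ = next.card * (M ^ j * T) := by simp
        _ ≤ M * (M ^ j * T) := Nat.mul_le_mul_right _ hM
        _ = M ^ (j + 1) * T := by ring
  exact key d 0 p₀ (by omega) h₀ bad subset_rfl (fun x _ => hsub x)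

/-! ### Vertex sets, transversals, colorings and identifying maps. -/

section Approximation

variable {U I K : Type} [Fintype U] [Fintype I] [Fintype K]
  [DecidableEq U] [DecidableEq I] [DecidableEq K]

/-- The vertex set `W` is contained in the transversal `{(u, a u)}`. -/
def InTransversal (W : Finset (U × I)) (a : U → I) : Prop := ∀ x ∈ W, a x.1 = x.2

/-- The coloring `b` is constant on the fibres of `f`. -/
def Respects {V : Type} (f : V → V) (b : V → K) : Prop := ∀ x, b (f x) = b x

/-- Two different elements of `W` are identified by `f`. -/
def Hits {V γ : Type} (W : Finset V) (f : V → γ) : Prop := ∃ x ∈ W, ∃ y ∈ W, x ≠ y ∧ f x = f y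

/-- The points moved by `f`. -/
def moved {V : Type} [Fintype V] [DecidableEq V] (f : V → V) : Finset V :=
  Finset.univ.filter fun x => f x ≠ x

/-- The map that sends the fibre of `f` through `y` to `f x`. -/
def merge {V : Type} [DecidableEq V] (f : V → V) (x y : V) : V → V :=
  fun z => if f z = f y then f x else f z

/-- `f` is idempotent. -/
def Idem {V : Type} (f : V → V) : Prop := ∀ x, f (f x) = f x

/-- Overwriting `a` by arbitrary values in the blocks met by `W` loses no information, since `W`
itself tells how to restore `a` there. -/
theorem card_inTransversal_mul_le (W : Finset (U × I)) (E : Finset (U → I))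
    (hE : ∀ a ∈ E, InTransversal W a) :
    E.card * Fintype.card I ^ W.card ≤ Fintype.card I ^ Fintype.card U := by
  have h : Fintype.card (E × (W → I)) ≤ Fintype.card (U → I) := by
    refine Fintype.card_le_of_injective
      (fun p : E × (W → I) => fun u => if h : (u, p.1.1 u) ∈ W then p.2 ⟨_, h⟩ else p.1.1 u) ?_
    rintro ⟨⟨a, ha⟩, g⟩ ⟨⟨a', ha'⟩, g'⟩ h
    have haa : a = a' := by
      funext u
      have hu := congrFun h u
      -- A vertex of `W` lies on both transversals, so they could differ only in a block where
      -- neither was overwritten.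
      by_cases h1 : (u, a u) ∈ W
      · exact (hE a' ha' _ h1).symm
      · by_cases h2 : (u, a' u) ∈ W
        · exact hE a ha _ h2
        · simpa [h1, h2] using hu
    subst haa
    have hg : g = g' := by
      funext x
      obtain ⟨⟨u, i⟩, hx⟩ := x
      have hu := congrFun h u
      have hi : a u = i := hE a ha _ hx
      subst hi
      simpa [hx] using hu
    rw [hg]
  simpa using h

variable {V : Type} [Fintype V] [DecidableEq V]

/-- A coloring constant on the fibres is determined by its values at the fixed points `f x`, so its
values at the moved points can be overwritten freely and still be restored. -/
theorem card_respects_mul_le (f : V → V) (hf : Idem f) (E : Finset (V → K))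
    (hE : ∀ b ∈ E, Respects f b) :
    E.card * Fintype.card K ^ (moved f).card ≤ Fintype.card K ^ Fintype.card V := by
  have h : Fintype.card (E × (moved f → K)) ≤ Fintype.card (V → K) := by
    refine Fintype.card_le_of_injective
      (fun p : E × (moved f → K) => fun x => if h : x ∈ moved f then p.2 ⟨_, h⟩ else p.1.1 x) ?_
    rintro ⟨⟨b, hb⟩, g⟩ ⟨⟨b', hb'⟩, g'⟩ h
    have hbb : b = b' := by
      funext x
      have hx := congrFun h (f x)
      have hm : f x ∉ moved f := by simp [moved, hf x]
      rw [← hE b hb x, ← hE b' hb' x]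
      simpa [hm] using hx
    subst hbb
    have hg : g = g' := by
      funext ⟨x, hx⟩
      simpa [hx] using congrFun h x
    rw [hg]
  simpa using h

/-! ### Merging two fibres of an idempotent map. -/

theorem idem_merge {f : V → V} (hf : Idem f) (x y : V) : Idem (merge f x y) := by
  intro z
  unfold merge
  by_cases h : f z = f y
  · simp [h, hf x]
  · simp [h, hf z]

theorem mem_moved {f : V → V} {x : V} : x ∈ moved f ↔ f x ≠ x := by
  simp [moved]

/-- In the absorbed fibre only the representative `f y` was fixed before. Thus a merge costs exactly
one moved point, which lets the number of moved points serve as the level in the branching. -/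
theorem moved_merge {f : V → V} (hf : Idem f) {x y : V} (hxy : f x ≠ f y) :
    moved (merge f x y) = insert (f y) (moved f) := by
  ext z
  rw [Finset.mem_insert, mem_moved, mem_moved, merge]
  by_cases h : f z = f y
  · rw [if_pos h]
    constructor
    · intro h1
      by_contra! h2
      exact h2.1 (by rw [← h, h2.2])
    · intro h1 h2
      apply hxy
      rw [← h, ← h2, hf]
  · rw [if_neg h]
    constructor
    · exact Or.inr
    · rintro (rfl | h1)
      · exact absurd (hf y) h
      · exact h1

theorem card_moved_merge {f : V → V} (hf : Idem f) {x y : V} (hxy : f x ≠ f y) :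
    (moved (merge f x y)).card = (moved f).card + 1 := by
  rw [moved_merge hf hxy, Finset.card_insert_of_notMem]
  simp [moved, hf y]

theorem respects_merge {f : V → V} {b : V → K} (hb : Respects f b) {x y : V} (h : b x = b y) :
    Respects (merge f x y) b := by
  intro z
  unfold merge
  split_ifs with hz
  · rw [hb, h, ← hb y, ← hz, hb]
  · exact hb z

theorem idem_id : Idem (id : V → V) := fun _ => rfl

theorem moved_id : moved (id : V → V) = ∅ := by simp [moved]

/-- Few transversals hit every map in `𝒞` without a small subset doing so. -/
theorem card_transversal_errors_le (v s : ℕ) (𝒞 : Set (U × I → U × I))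
    (h𝒞 : ∀ f ∈ 𝒞, (moved f).card ≤ s) (bad : Finset (U → I))
    (hhit : ∀ a ∈ bad, ∀ f ∈ 𝒞, ∃ x y : U × I, x ≠ y ∧ a x.1 = x.2 ∧ a y.1 = y.2 ∧ f x = f y)
    (hbad : ∀ a ∈ bad, ∀ W : Finset (U × I), W.card ≤ v → InTransversal W a →
      ¬ ∀ f ∈ 𝒞, Hits W f) :
    bad.card * Fintype.card I ^ (v + 1) ≤
      (2 * s) ^ (v + 1) * Fintype.card I ^ Fintype.card U := by
  refine card_mul_le_of_branching InTransversal (fun r W => W.card = r) bad (2 * s) _ _ (v + 1)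
    ?_ ?_ ∅ rfl (by simp [InTransversal])
  · rintro W hW E hE
    rw [← hW]
    exact card_inTransversal_mul_le W E hE
  · intro r W hr hW
    -- At a level below `v + 1` the set `W` is small, so if it hits all of `𝒞`, no bad transversal
    -- contains it and no child is needed.
    by_cases hall : ∀ f ∈ 𝒞, Hits W f
    · exact ⟨∅, by simp, by simp, fun a ha hWa =>
        absurd hall (hbad a ha W (by omega) hWa)⟩
    · push Not at hall
      obtain ⟨f, hf, hnot⟩ := hall
      -- Both ends of a collision of `f` are moved points or images of moved points, which leaves at
      -- most `2 * s` candidates. As `W` contains no collision of `f`, one end is a new vertex.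
      refine ⟨((moved f ∪ (moved f).image f) \ W).image (insert · W), ?_, ?_, ?_⟩
      · have h1 := h𝒞 f hf
        have h2 : ((moved f).image f).card ≤ (moved f).card := Finset.card_image_le
        have h3 := Finset.card_union_le (moved f) ((moved f).image f)
        have h4 := Finset.card_le_card
          (Finset.sdiff_subset : (moved f ∪ (moved f).image f) \ W ⊆ _)
        have h5 : (((moved f ∪ (moved f).image f) \ W).image (insert · W)).card ≤ _ :=
          Finset.card_image_le
        omega
      · intro p' hp'
        obtain ⟨x, hx, rfl⟩ := Finset.mem_image.1 hp'
        rw [Finset.card_insert_of_notMem (Finset.mem_sdiff.1 hx).2, hW]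
      · intro a ha hWa
        have hT : ∀ x y, x ≠ y → f x = f y → x ∈ moved f ∪ (moved f).image f := by
          intro x y hne hxy
          by_cases hx : f x = x
          · refine Finset.mem_union_right _ (Finset.mem_image.2 ⟨y, ?_, by rw [← hxy, hx]⟩)
            simp only [moved, Finset.mem_filter, Finset.mem_univ, true_and]
            intro hy
            exact hne (by rw [← hx, hxy, hy])
          · exact Finset.mem_union_left _ (by simp [moved, hx])
        have hins : ∀ x, a x.1 = x.2 → InTransversal (insert x W) a := by
          intro x hx z hz
          rcases Finset.mem_insert.1 hz with rfl | hz
          · exact hx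
          · exact hWa z hz
        obtain ⟨x, y, hne, hx, hy, hxy⟩ := hhit a ha f hf
        by_cases hxW : x ∈ W
        · by_cases hyW : y ∈ W
          · exact absurd ⟨x, hxW, y, hyW, hne, hxy⟩ hnot
          · exact ⟨insert y W, Finset.mem_image.2 ⟨y, Finset.mem_sdiff.2
              ⟨hT y x hne.symm hxy.symm, hyW⟩, rfl⟩, hins y hy⟩
        · exact ⟨insert x W, Finset.mem_image.2 ⟨x, Finset.mem_sdiff.2
            ⟨hT x y hne hxy, hxW⟩, rfl⟩, hins x hx⟩

/-- Few colorings are non-injective on every set in `𝒟` without a map that moves few points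
being a reason for it. -/
theorem card_coloring_errors_le (v s : ℕ) (𝒟 : Set (Finset V))
    (h𝒟 : ∀ W ∈ 𝒟, W.card ≤ v) (bad : Finset (V → K))
    (hhit : ∀ b ∈ bad, ∀ W ∈ 𝒟, Hits W b)
    (hbad : ∀ b ∈ bad, ∀ f : V → V, Idem f → (moved f).card ≤ s → Respects f b →
      ¬ ∀ W ∈ 𝒟, Hits W f) :
    bad.card * Fintype.card K ^ (s + 1) ≤
      (v * v) ^ (s + 1) * Fintype.card K ^ Fintype.card V := by
  refine card_mul_le_of_branching Respects (fun r f => Idem f ∧ (moved f).card = r) bad (v * v)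
    _ _ (s + 1) ?_ ?_ id ⟨idem_id, by simp [moved_id]⟩ (fun _ _ => rfl)
  · rintro f ⟨hf, hr⟩ E hE
    rw [← hr]
    exact card_respects_mul_le f hf E hE
  · rintro r f hr ⟨hf, hfr⟩
    by_cases hall : ∀ W ∈ 𝒟, Hits W f
    · exact ⟨∅, by simp, by simp, fun b hb hfb =>
        absurd hall (hbad b hb f hf (by omega) hfb)⟩
    · push Not at hall
      obtain ⟨W, hW, hnot⟩ := hall
      -- A bad coloring identifies two points of `W` while `f` separates all of them; merging such a
      -- pair keeps the map respected and moves one more point.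
      refine ⟨W.offDiag.image fun p => merge f p.1 p.2, ?_, ?_, ?_⟩
      · refine Finset.card_image_le.trans ?_
        rw [Finset.offDiag_card]
        exact (Nat.sub_le _ _).trans (Nat.mul_le_mul (h𝒟 W hW) (h𝒟 W hW))
      · intro f' hf'
        obtain ⟨⟨x, y⟩, hxy, rfl⟩ := Finset.mem_image.1 hf'
        obtain ⟨hx, hy, hne⟩ := Finset.mem_offDiag.1 hxy
        have hfxy : f x ≠ f y := fun h => hnot ⟨x, hx, y, hy, hne, h⟩
        exact ⟨idem_merge hf x y, by rw [card_moved_merge hf hfxy, hfr]⟩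
      · intro b hb hfb
        obtain ⟨x, hx, y, hy, hne, hxy⟩ := hhit b hb W hW
        exact ⟨merge f x y, Finset.mem_image.2 ⟨(x, y), Finset.mem_offDiag.2 ⟨hx, hy, hne⟩, rfl⟩,
          respects_merge hfb hxy⟩

/-! ### Approximating rectangles -/

/-- Outside of the exceptional sets `Ep` and `En`, the transversals in `A` contain a set from `𝒟`
and the colorings in `B` respect a map from `𝒞`, where `𝒟` and `𝒞` consist of small objects and
every member of `𝒟` hits every member of `𝒞`. -/
def Approx (v s : ℕ) (Ep : Finset (U → I)) (En : Finset (U × I → K))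
    (A : Set (U → I)) (B : Set (U × I → K)) : Prop :=
  ∃ (𝒟 : Set (Finset (U × I))) (𝒞 : Set (U × I → U × I)),
    (∀ W ∈ 𝒟, W.card ≤ v) ∧ (∀ f ∈ 𝒞, Idem f ∧ (moved f).card ≤ s) ∧
    (∀ W ∈ 𝒟, ∀ f ∈ 𝒞, Hits W f) ∧
    (∀ a ∈ A, a ∉ Ep → ∃ W ∈ 𝒟, InTransversal W a) ∧
    (∀ b ∈ B, b ∉ En → ∃ f ∈ 𝒞, Respects f b)

variable {v s : ℕ} {Ep Ep' : Finset (U → I)} {En En' : Finset (U × I → K)}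
  {A A' A₁ A₂ : Set (U → I)} {B B' B₁ B₂ : Set (U × I → K)}

theorem Approx.mono (h : Approx v s Ep En A B) (hEp : Ep ⊆ Ep') (hEn : En ⊆ En')
    (hA : A' ⊆ A) (hB : B' ⊆ B) : Approx v s Ep' En' A' B' := by
  obtain ⟨𝒟, 𝒞, h1, h2, h3, h4, h5⟩ := h
  exact ⟨𝒟, 𝒞, h1, h2, h3, fun a ha hE => h4 a (hA ha) fun h => hE (hEp h),
    fun b hb hE => h5 b (hB hb) fun h => hE (hEn h)⟩

/-- Every coloring respects the identity, and with `𝒟` empty there is nothing for it to collapse.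
The next lemma is dual, with the empty vertex set. -/
theorem Approx.of_left_empty : Approx v s Ep En ∅ B :=
  ⟨∅, {id}, by simp, by simp [idem_id, moved_id], by simp, by simp,
    fun _ _ _ => ⟨id, rfl, fun _ => rfl⟩⟩

theorem Approx.of_right_empty : Approx v s Ep En A ∅ :=
  ⟨{∅}, ∅, by simp, by simp, by simp, fun _ _ _ => ⟨∅, rfl, by simp [InTransversal]⟩, by simp⟩

/-- The set `{x, y}` and the map identifying `x` with `y` describe the rectangle without error,
which makes edges the free inputs of a program. -/
theorem Approx.edge (hv : 2 ≤ v) (hs : 1 ≤ s) {x y : U × I} (hxy : x ≠ y) :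
    Approx v s Ep En {a | a x.1 = x.2 ∧ a y.1 = y.2} {b | b x = b y} := by
  refine ⟨{{x, y}}, {merge id x y}, ?_, ?_, ?_, ?_, ?_⟩
  · rintro W rfl
    exact (Finset.card_pair hxy).le.trans hv
  · rintro f rfl
    refine ⟨idem_merge idem_id x y, ?_⟩
    rw [card_moved_merge idem_id hxy]
    simpa [moved_id] using hs
  · rintro W rfl f rfl
    exact ⟨x, by simp, y, by simp, hxy, by simp [merge]⟩
  · rintro a ⟨hx, hy⟩ _
    refine ⟨_, rfl, ?_⟩
    intro z hz
    rcases Finset.mem_insert.1 hz with rfl | hz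
    · exact hx
    · rw [Finset.mem_singleton.1 hz, hy]
  · intro b hb _
    exact ⟨_, rfl, respects_merge (fun _ => rfl) hb⟩

/-- Keep all maps, so that no coloring is lost, and replace `𝒟` by all small sets hit by every map.
A transversal in `A₁ ∩ A₂` outside `Ep` contains a set from each old family and hence a collision of
each map; it is lost only if no small part of it suffices for all maps, the event bounded by
`card_transversal_errors_le`. -/
theorem Approx.and (h₁ : Approx v s Ep En A₁ B₁) (h₂ : Approx v s Ep En A₂ B₂) :
    ∃ E : Finset (U → I),
      E.card * Fintype.card I ^ (v + 1) ≤ (2 * s) ^ (v + 1) * Fintype.card I ^ Fintype.card U ∧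
      Approx v s (Ep ∪ E) En (A₁ ∩ A₂) (B₁ ∪ B₂) := by
  classical
  obtain ⟨𝒟₁, 𝒞₁, -, hC₁, hH₁, hA₁, hB₁⟩ := h₁
  obtain ⟨𝒟₂, 𝒞₂, -, hC₂, hH₂, hA₂, hB₂⟩ := h₂
  have hC : ∀ f ∈ 𝒞₁ ∪ 𝒞₂, Idem f ∧ (moved f).card ≤ s := by
    rintro f (hf | hf)
    exacts [hC₁ f hf, hC₂ f hf]
  refine ⟨Finset.univ.filter fun a => (∀ f ∈ 𝒞₁ ∪ 𝒞₂, ∃ x y : U × I, x ≠ y ∧ a x.1 = x.2 ∧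
      a y.1 = y.2 ∧ f x = f y) ∧ ∀ W : Finset (U × I), W.card ≤ v → InTransversal W a →
      ¬ ∀ f ∈ 𝒞₁ ∪ 𝒞₂, Hits W f, ?_, ?_⟩
  · refine card_transversal_errors_le v s (𝒞₁ ∪ 𝒞₂) (fun f hf => (hC f hf).2) _ ?_ ?_
    · intro a ha
      exact (Finset.mem_filter.1 ha).2.1
    · intro a ha
      exact (Finset.mem_filter.1 ha).2.2
  · refine ⟨{W | W.card ≤ v ∧ ∀ f ∈ 𝒞₁ ∪ 𝒞₂, Hits W f}, 𝒞₁ ∪ 𝒞₂, fun W hW => hW.1, hC,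
      fun W hW => hW.2, ?_, ?_⟩
    · rintro a ⟨ha₁, ha₂⟩ hE
      rw [Finset.mem_union, not_or] at hE
      obtain ⟨W₁, hW₁, hWa₁⟩ := hA₁ a ha₁ hE.1
      obtain ⟨W₂, hW₂, hWa₂⟩ := hA₂ a ha₂ hE.1
      by_contra! hno
      refine hE.2 (Finset.mem_filter.2 ⟨Finset.mem_univ _, ?_, ?_⟩)
      · rintro f (hf | hf)
        · obtain ⟨x, hx, y, hy, hne, hxy⟩ := hH₁ W₁ hW₁ f hf
          exact ⟨x, y, hne, hWa₁ x hx, hWa₁ y hy, hxy⟩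
        · obtain ⟨x, hx, y, hy, hne, hxy⟩ := hH₂ W₂ hW₂ f hf
          exact ⟨x, y, hne, hWa₂ x hx, hWa₂ y hy, hxy⟩
      · intro W hW hWa hall
        exact hno W ⟨hW, hall⟩ hWa
    · rintro b (hb | hb) hE
      · obtain ⟨f, hf, h⟩ := hB₁ b hb hE
        exact ⟨f, Or.inl hf, h⟩
      · obtain ⟨f, hf, h⟩ := hB₂ b hb hE
        exact ⟨f, Or.inr hf, h⟩

theorem Hits.of_respects {W : Finset V} {f : V → V} {b : V → K} (h : Hits W f)
    (hb : Respects f b) : Hits W b := by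
  obtain ⟨x, hx, y, hy, hne, hxy⟩ := h
  exact ⟨x, hx, y, hy, hne, by rw [← hb x, hxy, hb]⟩

/-- Dual to `Approx.and`: all vertex sets are kept, the maps are chosen anew, and
`card_coloring_errors_le` bounds the lost colorings. -/
theorem Approx.or (h₁ : Approx v s Ep En A₁ B₁) (h₂ : Approx v s Ep En A₂ B₂) :
    ∃ E : Finset (U × I → K),
      E.card * Fintype.card K ^ (s + 1) ≤
        (v * v) ^ (s + 1) * Fintype.card K ^ Fintype.card (U × I) ∧
      Approx v s Ep (En ∪ E) (A₁ ∪ A₂) (B₁ ∩ B₂) := by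
  classical
  obtain ⟨𝒟₁, 𝒞₁, hD₁, -, hH₁, hA₁, hB₁⟩ := h₁
  obtain ⟨𝒟₂, 𝒞₂, hD₂, -, hH₂, hA₂, hB₂⟩ := h₂
  have hD : ∀ W ∈ 𝒟₁ ∪ 𝒟₂, W.card ≤ v := by
    rintro W (hW | hW)
    exacts [hD₁ W hW, hD₂ W hW]
  refine ⟨Finset.univ.filter fun b => (∀ W ∈ 𝒟₁ ∪ 𝒟₂, Hits W b) ∧
      ∀ f : U × I → U × I, Idem f → (moved f).card ≤ s → Respects f b →
      ¬ ∀ W ∈ 𝒟₁ ∪ 𝒟₂, Hits W f, ?_, ?_⟩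
  · refine card_coloring_errors_le v s (𝒟₁ ∪ 𝒟₂) hD _ ?_ ?_
    · intro b hb
      exact (Finset.mem_filter.1 hb).2.1
    · intro b hb
      exact (Finset.mem_filter.1 hb).2.2
  · refine ⟨𝒟₁ ∪ 𝒟₂, {f | (Idem f ∧ (moved f).card ≤ s) ∧ ∀ W ∈ 𝒟₁ ∪ 𝒟₂, Hits W f}, hD,
      fun f hf => hf.1, fun W hW f hf => hf.2 W hW, ?_, ?_⟩
    · rintro a (ha | ha) hE
      · obtain ⟨W, hW, h⟩ := hA₁ a ha hE
        exact ⟨W, Or.inl hW, h⟩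
      · obtain ⟨W, hW, h⟩ := hA₂ a ha hE
        exact ⟨W, Or.inr hW, h⟩
    · rintro b ⟨hb₁, hb₂⟩ hE
      rw [Finset.mem_union, not_or] at hE
      obtain ⟨f₁, hf₁, hfb₁⟩ := hB₁ b hb₁ hE.1
      obtain ⟨f₂, hf₂, hfb₂⟩ := hB₂ b hb₂ hE.1
      by_contra! hno
      refine hE.2 (Finset.mem_filter.2 ⟨Finset.mem_univ _, ?_, ?_⟩)
      · rintro W (hW | hW)
        · exact (hH₁ W hW f₁ hf₁).of_respects hfb₁
        · exact (hH₂ W hW f₂ hf₂).of_respects hfb₂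
      · intro f hf hfs hfb hall
        exact hno f ⟨⟨hf, hfs⟩, hall⟩ hfb

/-- If the full rectangle is approximated, then one of the exceptional sets is large. -/
theorem Approx.large_error (h : Approx v s Ep En Set.univ Set.univ)
    (hK : 2 * (v * v) ≤ Fintype.card K) (hK0 : 0 < Fintype.card K) :
    Fintype.card I ^ Fintype.card U ≤ Ep.card ∨
      Fintype.card K ^ Fintype.card (U × I) ≤ 2 * En.card := by
  classical
  obtain ⟨𝒟, 𝒞, hD, hC, hH, hA, hB⟩ := h
  by_cases hall : ∀ a, a ∈ Ep
  · left
    rw [Finset.eq_univ_iff_forall.2 hall]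
    simp
  · right
    push Not at hall
    obtain ⟨a, ha⟩ := hall
    -- One surviving `W` is enough: every coloring outside `En` respects a map that collapses a pair
    -- of `W`, so it is not injective on `W`. A union bound over pairs leaves at most a fraction `v
    -- * v / |K| ≤ 1/2` of such colorings.
    obtain ⟨W, hW, -⟩ := hA a trivial ha
    let S : U × I → U × I → Finset (U × I → K) := fun x y => Finset.univ.filter fun b => b x = b y
    have hS : ∀ x y, x ≠ y →
        (S x y).card * Fintype.card K ≤ Fintype.card K ^ Fintype.card (U × I) := by
      intro x y hxy
      have := card_respects_mul_le (merge id x y) (idem_merge idem_id x y) (S x y) (by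
        intro b hb
        exact respects_merge (fun _ => rfl) (Finset.mem_filter.1 hb).2)
      rw [card_moved_merge idem_id hxy] at this
      simpa [moved_id] using this
    have hcover : (Finset.univ : Finset (U × I → K)) ⊆
        En ∪ W.offDiag.biUnion fun p => S p.1 p.2 := by
      intro b _
      by_cases hb : b ∈ En
      · exact Finset.mem_union_left _ hb
      · obtain ⟨f, hf, hfb⟩ := hB b trivial hb
        obtain ⟨x, hx, y, hy, hne, hxy⟩ := (hH W hW f hf).of_respects hfb
        refine Finset.mem_union_right _ (Finset.mem_biUnion.2 ⟨(x, y),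
          Finset.mem_offDiag.2 ⟨hx, hy, hne⟩, Finset.mem_filter.2 ⟨Finset.mem_univ _, hxy⟩⟩)
    set T := Fintype.card K ^ Fintype.card (U × I) with hT
    have h1 : T ≤ En.card + ∑ p ∈ W.offDiag, (S p.1 p.2).card := by
      have := (Finset.card_le_card hcover).trans (Finset.card_union_le _ _)
      have h2 := (Finset.card_biUnion_le (s := W.offDiag) (t := fun p => S p.1 p.2))
      have h3 : (Finset.univ : Finset (U × I → K)).card = T := by
        rw [hT, Finset.card_univ, Fintype.card_fun]
      omega
    have h2 : (∑ p ∈ W.offDiag, (S p.1 p.2).card) * Fintype.card K ≤ v * v * T := by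
      rw [Finset.sum_mul]
      calc ∑ p ∈ W.offDiag, (S p.1 p.2).card * Fintype.card K ≤ ∑ _p ∈ W.offDiag, T :=
            Finset.sum_le_sum fun p hp => hS _ _ (Finset.mem_offDiag.1 hp).2.2
        _ = W.offDiag.card * T := by simp
        _ ≤ v * v * T := by
            refine Nat.mul_le_mul_right _ ?_
            rw [Finset.offDiag_card]
            exact (Nat.sub_le _ _).trans (Nat.mul_le_mul (hD W hW) (hD W hW))
    refine Nat.le_of_mul_le_mul_right ?_ hK0
    nlinarith [Nat.mul_le_mul_right T hK]

/-! ### Programs over rectangles -/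

/-- All rectangles in `S` can be approximated simultaneously, with the errors of `t` gates. -/
def Covers (s t : ℕ) (S : Set (Set (U → I) × Set (U × I → K))) : Prop :=
  ∃ (Ep : Finset (U → I)) (En : Finset (U × I → K)),
    Ep.card * Fintype.card I ^ (s + 1) ≤
      t * ((2 * s) ^ (s + 1) * Fintype.card I ^ Fintype.card U) ∧
    En.card * Fintype.card K ^ (s + 1) ≤
      t * ((s * s) ^ (s + 1) * Fintype.card K ^ Fintype.card (U × I)) ∧
    ∀ R ∈ S, Approx s s Ep En R.1 R.2

variable {t t' : ℕ} {S S' : Set (Set (U → I) × Set (U × I → K))}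

theorem Covers.empty : Covers s 0 (∅ : Set (Set (U → I) × Set (U × I → K))) :=
  ⟨∅, ∅, by simp, by simp, by simp⟩

theorem Covers.mono (h : Covers s t S) (ht : t ≤ t') (hS : S' ⊆ S) : Covers s t' S' := by
  obtain ⟨Ep, En, h1, h2, h3⟩ := h
  exact ⟨Ep, En, h1.trans (Nat.mul_le_mul_right _ ht), h2.trans (Nat.mul_le_mul_right _ ht),
    fun R hR => h3 R (hS hR)⟩

theorem Covers.insert (h : Covers s t S)
    (hR : ∀ Ep En, (∀ R ∈ S, Approx s s Ep En R.1 R.2) → Approx s s Ep En A B) :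
    Covers s t (insert (A, B) S) := by
  obtain ⟨Ep, En, h1, h2, h3⟩ := h
  refine ⟨Ep, En, h1, h2, ?_⟩
  rintro R (rfl | hR')
  exacts [hR Ep En h3, h3 R hR']

theorem Covers.left_empty (h : Covers s t S) : Covers s t (Insert.insert (∅, B) S) :=
  h.insert fun _ _ _ => Approx.of_left_empty

theorem Covers.right_empty (h : Covers s t S) : Covers s t (Insert.insert (A, ∅) S) :=
  h.insert fun _ _ _ => Approx.of_right_empty

theorem Covers.edge (h : Covers s t S) (hs : 2 ≤ s) {x y : U × I} (hxy : x ≠ y)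
    (hA : A ⊆ {a | a x.1 = x.2 ∧ a y.1 = y.2}) (hB : B ⊆ {b | b x = b y}) :
    Covers s t (Insert.insert (A, B) S) :=
  h.insert fun _ _ _ => (Approx.edge hs (by omega) hxy).mono subset_rfl subset_rfl hA hB

theorem Covers.weaken (h : Covers s t S) (h₁ : (A₁, B₁) ∈ S) (hA : A ⊆ A₁) (hB : B ⊆ B₁) :
    Covers s t (Insert.insert (A, B) S) :=
  h.insert fun _ _ hS => (hS _ h₁).mono subset_rfl subset_rfl hA hB

/-- The exceptional sets are shared by all rectangles, so the error of a new gate is simply added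
once, and old approximations survive by monotonicity. Inclusions suffice, so rectangles need not be
computed exactly. -/
theorem Covers.and (h : Covers s t S) (h₁ : (A₁, B₁) ∈ S) (h₂ : (A₂, B₂) ∈ S)
    (hA₁ : A ⊆ A₁) (hA₂ : A ⊆ A₂) (hB : B ⊆ B₁ ∪ B₂) :
    Covers s (t + 1) (Insert.insert (A, B) S) := by
  obtain ⟨Ep, En, hp, hn, hS⟩ := h
  obtain ⟨E, hE, hE'⟩ := (hS _ h₁).and (hS _ h₂)
  refine ⟨Ep ∪ E, En, ?_, hn.trans (Nat.mul_le_mul_right _ (Nat.le_succ t)), ?_⟩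
  · calc _ ≤ (Ep.card + E.card) * Fintype.card I ^ (s + 1) :=
          Nat.mul_le_mul_right _ (Finset.card_union_le _ _)
      _ ≤ _ := by rw [add_mul, add_mul, one_mul]; exact Nat.add_le_add hp hE
  · rintro R (rfl | hR)
    · exact hE'.mono subset_rfl subset_rfl (Set.subset_inter hA₁ hA₂) hB
    · exact (hS R hR).mono Finset.subset_union_left subset_rfl subset_rfl subset_rfl

theorem Covers.or (h : Covers s t S) (h₁ : (A₁, B₁) ∈ S) (h₂ : (A₂, B₂) ∈ S)
    (hA : A ⊆ A₁ ∪ A₂) (hB₁ : B ⊆ B₁) (hB₂ : B ⊆ B₂) :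
    Covers s (t + 1) (Insert.insert (A, B) S) := by
  obtain ⟨Ep, En, hp, hn, hS⟩ := h
  obtain ⟨E, hE, hE'⟩ := (hS _ h₁).or (hS _ h₂)
  refine ⟨Ep, En ∪ E, hp.trans (Nat.mul_le_mul_right _ (Nat.le_succ t)), ?_, ?_⟩
  · calc _ ≤ (En.card + E.card) * Fintype.card K ^ (s + 1) :=
          Nat.mul_le_mul_right _ (Finset.card_union_le _ _)
      _ ≤ _ := by rw [add_mul, add_mul, one_mul]; exact Nat.add_le_add hn hE
  · rintro R (rfl | hR)
    · exact hE'.mono subset_rfl subset_rfl hA (Set.subset_inter hB₁ hB₂)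
    · exact (hS R hR).mono subset_rfl Finset.subset_union_left subset_rfl subset_rfl

/-- Deriving the full rectangle takes exponentially many gates. -/
theorem Covers.two_pow_le (h : Covers s t S) (hfull : (Set.univ, Set.univ) ∈ S)
    (hs : 1 ≤ s) (hI : 4 * s ≤ Fintype.card I) (hK : 2 * (s * s) ≤ Fintype.card K) :
    2 ^ s ≤ t := by
  obtain ⟨Ep, En, hp, hn, hS⟩ := h
  have hss : 0 < s * s := by positivity
  rcases (hS _ hfull).large_error hK (by omega) with h1 | h1
  · set T := Fintype.card I ^ Fintype.card U with hT
    have hT0 : 0 < T := pow_pos (by omega) _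
    have h2 : 2 ^ (s + 1) * ((2 * s) ^ (s + 1) * T) ≤ t * ((2 * s) ^ (s + 1) * T) :=
      calc 2 ^ (s + 1) * ((2 * s) ^ (s + 1) * T) = T * (4 * s) ^ (s + 1) := by
            rw [show 4 * s = 2 * (2 * s) by ring, mul_pow 2 (2 * s)]; ring
        _ ≤ Ep.card * Fintype.card I ^ (s + 1) :=
            Nat.mul_le_mul h1 (Nat.pow_le_pow_left hI _)
        _ ≤ _ := hp
    have h3 := Nat.le_of_mul_le_mul_right h2 (by positivity)
    rw [pow_succ] at h3
    omega
  · set T := Fintype.card K ^ Fintype.card (U × I) with hT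
    have hT0 : 0 < T := pow_pos (by omega) _
    -- Only half of the colorings are known to be exceptional, whence `2 * t`; the exponent `s + 1`
    -- pays for this factor.
    have h2 : 2 ^ (s + 1) * ((s * s) ^ (s + 1) * T) ≤ (2 * t) * ((s * s) ^ (s + 1) * T) :=
      calc 2 ^ (s + 1) * ((s * s) ^ (s + 1) * T) = T * (2 * (s * s)) ^ (s + 1) := by
            rw [mul_pow 2 (s * s)]; ring
        _ ≤ (2 * En.card) * Fintype.card K ^ (s + 1) :=
            Nat.mul_le_mul h1 (Nat.pow_le_pow_left hK _)
        _ = 2 * (En.card * Fintype.card K ^ (s + 1)) := by ring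
        _ ≤ 2 * (t * ((s * s) ^ (s + 1) * T)) := Nat.mul_le_mul_left _ hn
        _ = _ := by ring
    have h3 := Nat.le_of_mul_le_mul_right h2 (by positivity)
    rw [pow_succ] at h3
    omega

end Approximation

/-! ### Test assignments -/

section Assignments

variable {k m l n : ℕ}

/-- The number of the vertex `x`: the vertices below `k * m` are split into `k` blocks of
size `m`. -/
def vertexCode (x : Fin k × Fin m) : ℕ := finProdFinEquiv x

theorem vertexCode_injective : Function.Injective (vertexCode : Fin k × Fin m → ℕ) :=
  Fin.val_injective.comp finProdFinEquiv.injective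

theorem vertexCode_lt (x : Fin k × Fin m) : vertexCode x < k * m := (finProdFinEquiv x).isLt

open Classical in
/-- The assignment in which `q` enumerates the transversal `a` and `p` is the clique on it. -/
noncomputable def cliqueAssign (a : Fin k → Fin m) (z : ℕ) : Bool :=
  if z % 3 = 0 then
    decide ((z / 3).unpair.1 ≠ (z / 3).unpair.2 ∧
      (∃ u, vertexCode (u, a u) = (z / 3).unpair.1) ∧ ∃ u, vertexCode (u, a u) = (z / 3).unpair.2)
  else if z % 3 = 1 then
    decide (∃ u : Fin k, u = (z / 3).unpair.1 ∧ vertexCode (u, a u) = (z / 3).unpair.2)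
  else false

/-- The color of the vertex with number `i`; vertices outside of the blocks get color `0`. -/
def colorOf [NeZero l] (b : Fin k × Fin m → Fin l) (i : ℕ) : Fin l :=
  if h : i < k * m then b (finProdFinEquiv.symm ⟨i, h⟩) else 0

theorem colorOf_vertexCode [NeZero l] (b : Fin k × Fin m → Fin l) (x : Fin k × Fin m) :
    colorOf b (vertexCode x) = b x := by
  rw [colorOf, dif_pos (vertexCode_lt x)]
  exact congrArg b (finProdFinEquiv.symm_apply_apply x)

/-- The assignment in which `r` is the coloring `b` and `p` is the complete multipartite graph
given by the color classes. -/
def colorAssign [NeZero l] (b : Fin k × Fin m → Fin l) (z : ℕ) : Bool :=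
  if z % 3 = 0 then decide (colorOf b (z / 3).unpair.1 ≠ colorOf b (z / 3).unpair.2)
  else if z % 3 = 2 then decide ((colorOf b (z / 3).unpair.1 : ℕ) = (z / 3).unpair.2)
  else false

theorem cliqueAssign_edgeAtom (a : Fin k → Fin m) (i j : ℕ) :
    cliqueAssign a (edgeAtom i j) = true ↔
      i ≠ j ∧ (∃ u, vertexCode (u, a u) = i) ∧ ∃ u, vertexCode (u, a u) = j := by
  simp [cliqueAssign, edgeAtom]

theorem cliqueAssign_cliqueAtom (a : Fin k → Fin m) (u i : ℕ) :
    cliqueAssign a (cliqueAtom u i) = true ↔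
      ∃ u' : Fin k, u' = u ∧ vertexCode (u', a u') = i := by
  have h1 : (3 * Nat.pair u i + 1) % 3 = 1 := by omega
  have h2 : (3 * Nat.pair u i + 1) / 3 = Nat.pair u i := by omega
  simp [cliqueAssign, cliqueAtom, h1, h2]

theorem colorAssign_edgeAtom [NeZero l] (b : Fin k × Fin m → Fin l) (i j : ℕ) :
    colorAssign b (edgeAtom i j) = true ↔ colorOf b i ≠ colorOf b j := by
  simp [colorAssign, edgeAtom]

theorem colorAssign_colorAtom [NeZero l] (b : Fin k × Fin m → Fin l) (i c : ℕ) :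
    colorAssign b (colorAtom i c) = true ↔ (colorOf b i : ℕ) = c := by
  have h1 : (3 * Nat.pair i c + 2) % 3 = 2 := by omega
  have h2 : (3 * Nat.pair i c + 2) / 3 = Nat.pair i c := by omega
  simp [colorAssign, colorAtom, h1, h2]

theorem mem_distinctPairs {x : ℕ × ℕ} : x ∈ distinctPairs m ↔ x.1 < m ∧ x.2 < m ∧ x.1 ≠ x.2 := by
  obtain ⟨i, j⟩ := x
  simp [distinctPairs, and_assoc]

theorem mem_twoSubsets {x : ℕ × ℕ} : x ∈ twoSubsets m ↔ x.1 < m ∧ x.2 < m ∧ x.1 < x.2 := by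
  obtain ⟨i, j⟩ := x
  simp [twoSubsets, and_assoc]

theorem mem_cliqueClauses {C : Clause} : C ∈ cliqueClauses k n ↔
    (∃ u < k, C = (List.range n).map fun i => Literal.pos (cliqueAtom u i)) ∨
    (∃ u < k, ∃ i < n, ∃ j < n, i ≠ j ∧
      C = [Literal.neg (cliqueAtom u i), Literal.neg (cliqueAtom u j)]) ∨
    (∃ u < k, ∃ w < k, u ≠ w ∧ ∃ i < n,
      C = [Literal.neg (cliqueAtom u i), Literal.neg (cliqueAtom w i)]) ∨
    (∃ u < k, ∃ w < k, u ≠ w ∧ ∃ i < n, ∃ j < n, i < j ∧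
      C = [Literal.neg (cliqueAtom u i), Literal.neg (cliqueAtom w j),
        Literal.pos (edgeAtom i j)]) := by
  simp only [cliqueClauses, List.mem_append, List.mem_map, List.mem_product, mem_distinctPairs,
    mem_twoSubsets, List.mem_range, Prod.exists, or_assoc]
  refine or_congr ?_ (or_congr ?_ (or_congr ?_ ?_)) <;> constructor
  · rintro ⟨u, hu, rfl⟩; exact ⟨u, hu, rfl⟩
  · rintro ⟨u, hu, rfl⟩; exact ⟨u, hu, rfl⟩
  · rintro ⟨u, i, j, ⟨hu, hi, hj, h⟩, rfl⟩; exact ⟨u, hu, i, hi, j, hj, h, rfl⟩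
  · rintro ⟨u, hu, i, hi, j, hj, h, rfl⟩; exact ⟨u, i, j, ⟨hu, hi, hj, h⟩, rfl⟩
  · rintro ⟨u, w, i, ⟨⟨hu, hw, h⟩, hi⟩, rfl⟩; exact ⟨u, hu, w, hw, h, i, hi, rfl⟩
  · rintro ⟨u, hu, w, hw, h, i, hi, rfl⟩; exact ⟨u, w, i, ⟨⟨hu, hw, h⟩, hi⟩, rfl⟩
  · rintro ⟨u, w, i, j, ⟨⟨hu, hw, h⟩, hi, hj, h'⟩, rfl⟩
    exact ⟨u, hu, w, hw, h, i, hi, j, hj, h', rfl⟩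
  · rintro ⟨u, hu, w, hw, h, i, hi, j, hj, h', rfl⟩
    exact ⟨u, w, i, j, ⟨⟨hu, hw, h⟩, hi, hj, h'⟩, rfl⟩

theorem mem_colorClauses {C : Clause} : C ∈ colorClauses l n ↔
    (∃ i < n, C = (List.range l).map fun c => Literal.pos (colorAtom i c)) ∨
    (∃ i < n, ∃ c < l, ∃ d < l, c ≠ d ∧
      C = [Literal.neg (colorAtom i c), Literal.neg (colorAtom i d)]) ∨
    (∃ c < l, ∃ i < n, ∃ j < n, i < j ∧
      C = [Literal.neg (colorAtom i c), Literal.neg (colorAtom j c),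
        Literal.neg (edgeAtom i j)]) := by
  simp only [colorClauses, List.mem_append, List.mem_map, List.mem_product, mem_distinctPairs,
    mem_twoSubsets, List.mem_range, Prod.exists, or_assoc]
  refine or_congr ?_ (or_congr ?_ ?_) <;> constructor
  · rintro ⟨u, hu, rfl⟩; exact ⟨u, hu, rfl⟩
  · rintro ⟨u, hu, rfl⟩; exact ⟨u, hu, rfl⟩
  · rintro ⟨u, i, j, ⟨hu, hi, hj, h⟩, rfl⟩; exact ⟨u, hu, i, hi, j, hj, h, rfl⟩
  · rintro ⟨u, hu, i, hi, j, hj, h, rfl⟩; exact ⟨u, i, j, ⟨hu, hi, hj, h⟩, rfl⟩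
  · rintro ⟨u, i, j, ⟨hu, hi, hj, h⟩, rfl⟩; exact ⟨u, hu, i, hi, j, hj, h, rfl⟩
  · rintro ⟨u, hu, i, hi, j, hj, h, rfl⟩; exact ⟨u, i, j, ⟨hu, hi, hj, h⟩, rfl⟩

theorem holds_cliqueAssign (h : k * m ≤ n) (a : Fin k → Fin m) :
    ∀ C ∈ cliqueClauses k n, Clause.Holds (cliqueAssign a) C := by
  intro C hC
  rcases mem_cliqueClauses.1 hC with ⟨u, hu, rfl⟩ | ⟨u, hu, i, hi, j, hj, hne, rfl⟩ |
    ⟨u, hu, w, hw, hne, i, hi, rfl⟩ | ⟨u, hu, w, hw, hne, i, hi, j, hj, hij, rfl⟩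
  · refine ⟨Literal.pos (cliqueAtom u (vertexCode (⟨u, hu⟩, a ⟨u, hu⟩))),
      List.mem_map.2 ⟨_, List.mem_range.2 ((vertexCode_lt _).trans_le h), rfl⟩, ?_⟩
    exact (cliqueAssign_cliqueAtom a _ _).2 ⟨⟨u, hu⟩, rfl, rfl⟩
  · by_contra hno
    simp only [Clause.Holds, List.mem_cons, List.not_mem_nil, or_false, exists_eq_or_imp,
      exists_eq_left, Literal.eval, Bool.not_eq_true', not_or, Bool.not_eq_false,
      cliqueAssign_cliqueAtom] at hno
    obtain ⟨⟨u₁, rfl, rfl⟩, ⟨u₂, h₂, rfl⟩⟩ := hno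
    exact hne (by rw [Fin.ext h₂])
  · by_contra hno
    simp only [Clause.Holds, List.mem_cons, List.not_mem_nil, or_false, exists_eq_or_imp,
      exists_eq_left, Literal.eval, Bool.not_eq_true', not_or, Bool.not_eq_false,
      cliqueAssign_cliqueAtom] at hno
    obtain ⟨⟨u₁, rfl, rfl⟩, ⟨u₂, rfl, h₂⟩⟩ := hno
    exact hne (congrArg (fun x : Fin k × Fin m => (x.1 : ℕ)) (vertexCode_injective h₂)).symm
  · by_contra hno
    simp only [Clause.Holds, List.mem_cons, List.not_mem_nil, or_false, exists_eq_or_imp,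
      exists_eq_left, Literal.eval, Bool.not_eq_true', not_or, Bool.not_eq_false,
      cliqueAssign_cliqueAtom, cliqueAssign_edgeAtom] at hno
    obtain ⟨⟨u₁, rfl, h₁⟩, ⟨u₂, rfl, h₂⟩, h₃⟩ := hno
    exact h₃ ⟨hij.ne, ⟨u₁, h₁⟩, u₂, h₂⟩

theorem holds_colorAssign [NeZero l] (b : Fin k × Fin m → Fin l) :
    ∀ C ∈ colorClauses l n, Clause.Holds (colorAssign b) C := by
  intro C hC
  rcases mem_colorClauses.1 hC with ⟨i, hi, rfl⟩ | ⟨i, hi, c, hc, d, hd, hne, rfl⟩ |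
    ⟨c, hc, i, hi, j, hj, hij, rfl⟩
  · refine ⟨Literal.pos (colorAtom i (colorOf b i)),
      List.mem_map.2 ⟨_, List.mem_range.2 (colorOf b i).isLt, rfl⟩, ?_⟩
    exact (colorAssign_colorAtom b _ _).2 rfl
  · by_contra hno
    simp only [Clause.Holds, List.mem_cons, List.not_mem_nil, or_false, exists_eq_or_imp,
      exists_eq_left, Literal.eval, Bool.not_eq_true', not_or, Bool.not_eq_false,
      colorAssign_colorAtom] at hno
    exact hne (hno.1.symm.trans hno.2)
  · by_contra hno
    simp only [Clause.Holds, List.mem_cons, List.not_mem_nil, or_false, exists_eq_or_imp,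
      exists_eq_left, Literal.eval, Bool.not_eq_true', not_or, Bool.not_eq_false,
      colorAssign_colorAtom, colorAssign_edgeAtom] at hno
    exact hno.2.2 (Fin.ext (hno.1.trans hno.2.1.symm))

/-- The literals that belong to the clique part: those over the atoms `q`, and the positive ones
over the atoms `p`. -/
def CliqueSide : Literal → Prop
  | Literal.pos x => x % 3 ≠ 2
  | Literal.neg x => x % 3 = 1

/-- The literals that belong to the coloring part. -/
def ColorSide (L : Literal) : Prop := ¬ CliqueSide L

theorem cliqueSide_of_mem {C : Clause} (hC : C ∈ cliqueClauses k n) : ∀ L ∈ C, CliqueSide L := by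
  rcases mem_cliqueClauses.1 hC with ⟨u, hu, rfl⟩ | ⟨u, hu, i, hi, j, hj, hne, rfl⟩ |
    ⟨u, hu, w, hw, hne, i, hi, rfl⟩ | ⟨u, hu, w, hw, hne, i, hi, j, hj, hij, rfl⟩ <;>
  simp [CliqueSide, cliqueAtom, edgeAtom, Nat.add_mod]

theorem colorSide_of_mem {C : Clause} (hC : C ∈ colorClauses l n) : ∀ L ∈ C, ColorSide L := by
  rcases mem_colorClauses.1 hC with ⟨i, hi, rfl⟩ | ⟨i, hi, c, hc, d, hd, hne, rfl⟩ |
    ⟨c, hc, i, hi, j, hj, hij, rfl⟩ <;>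
  simp [ColorSide, CliqueSide, colorAtom, edgeAtom, Nat.add_mod]

/-- The rectangle of a transversal containing the edge `x` and a coloring for which `x` is not
an edge. -/
theorem Covers.edgeAtom [NeZero l] {s t x : ℕ}
    {S : Set (Set (Fin k → Fin m) × Set (Fin k × Fin m → Fin l))} (h : Covers s t S) (hs : 2 ≤ s)
    (hx : x % 3 = 0) {A : Set (Fin k → Fin m)} {B : Set (Fin k × Fin m → Fin l)}
    (hA : ∀ a ∈ A, cliqueAssign a x = true) (hB : ∀ b ∈ B, colorAssign b x = false) :
    Covers s t (Insert.insert (A, B) S) := by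
  obtain ⟨i, j, rfl⟩ : ∃ i j, x = ProofComplexity.edgeAtom i j :=
    ⟨(x / 3).unpair.1, (x / 3).unpair.2, by rw [ProofComplexity.edgeAtom, Nat.pair_unpair]; omega⟩
  -- A number pair that is no edge of any clique in `A` is harmless because `A` is then empty.
  -- Otherwise one `a₀` decodes the two numbers as block vertices, and by injectivity of
  -- `vertexCode` all of `A` passes through these.
  rcases Set.eq_empty_or_nonempty A with rfl | ⟨a₀, ha₀⟩
  · exact h.left_empty
  · obtain ⟨hij, ⟨u, hu⟩, ⟨w, hw⟩⟩ := (cliqueAssign_edgeAtom a₀ i j).1 (hA a₀ ha₀)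
    refine h.edge hs (x := (u, a₀ u)) (y := (w, a₀ w)) ?_ ?_ ?_
    · intro h
      exact hij (by rw [← hu, ← hw, h])
    · intro a ha
      obtain ⟨-, ⟨u', hu'⟩, ⟨w', hw'⟩⟩ := (cliqueAssign_edgeAtom a i j).1 (hA a ha)
      have h1 := vertexCode_injective (hu'.trans hu.symm)
      have h2 := vertexCode_injective (hw'.trans hw.symm)
      simp only [Prod.mk.injEq] at h1 h2
      obtain ⟨rfl, h1⟩ := h1
      obtain ⟨rfl, h2⟩ := h2
      exact ⟨h1, h2⟩
    · intro b hb
      have h1 := hB b hb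
      rw [← Bool.not_eq_true, colorAssign_edgeAtom, not_not, ← hu, ← hw, colorOf_vertexCode,
        colorOf_vertexCode] at h1
      exact h1

end Assignments

/-! ### Formulas on one side -/

/-- `φ` is built by `∧` and `∨` from literals with the property `P`. -/
inductive SideFormula (P : Literal → Prop) : Formula → Prop
  | lit (L : Literal) : P L → SideFormula P L.toFormula
  | and (φ ψ : Formula) : SideFormula P φ → SideFormula P ψ → SideFormula P (Formula.and φ ψ)
  | or (φ ψ : Formula) : SideFormula P φ → SideFormula P ψ → SideFormula P (Formula.or φ ψ)

namespace SideFormula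

variable {P : Literal → Prop} {φ ψ : Formula}

theorem atom_iff {x : ℕ} : SideFormula P (Formula.atom x) ↔ P (Literal.pos x) := by
  constructor
  · intro h
    generalize hφ : Formula.atom x = φ at h
    cases h with
    | lit L hL => cases L <;> simp_all [Literal.toFormula, Formula.neg]
    | and | or => cases hφ
  · exact fun h => lit _ h

theorem imp_iff : SideFormula P (Formula.imp φ ψ) ↔
    ∃ x, φ = Formula.atom x ∧ ψ = Formula.bot ∧ P (Literal.neg x) := by
  constructor
  · intro h
    generalize hφ : Formula.imp φ ψ = χ at h
    cases h with
    | lit L hL => cases L <;> simp_all [Literal.toFormula, Formula.neg]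
    | and | or => cases hφ
  · rintro ⟨x, rfl, rfl, h⟩
    exact lit _ h

theorem not_bot : ¬ SideFormula P Formula.bot := by
  intro h
  generalize hφ : Formula.bot = χ at h
  cases h with
  | lit L hL => cases L <;> simp_all [Literal.toFormula, Formula.neg]
  | and | or => cases hφ

theorem and_iff : SideFormula P (Formula.and φ ψ) ↔ SideFormula P φ ∧ SideFormula P ψ := by
  constructor
  · intro h
    generalize hφ : Formula.and φ ψ = χ at h
    cases h with
    | lit L hL => cases L <;> simp_all [Literal.toFormula, Formula.neg]
    | and φ ψ h1 h2 => cases hφ; exact ⟨h1, h2⟩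
    | or => cases hφ
  · rintro ⟨h1, h2⟩
    exact and _ _ h1 h2

theorem or_iff : SideFormula P (Formula.or φ ψ) ↔ SideFormula P φ ∧ SideFormula P ψ := by
  constructor
  · intro h
    generalize hφ : Formula.or φ ψ = χ at h
    cases h with
    | lit L hL => cases L <;> simp_all [Literal.toFormula, Formula.neg]
    | and => cases hφ
    | or φ ψ h1 h2 => cases hφ; exact ⟨h1, h2⟩
  · rintro ⟨h1, h2⟩
    exact or _ _ h1 h2

/-- A side formula is never built from constants alone, so descending to the left always reaches a
literal, and that literal decides the side. -/
theorem disjoint {Q : Literal → Prop} (hPQ : ∀ L, P L → ¬ Q L) (h : SideFormula P φ) :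
    ¬ SideFormula Q φ := by
  induction h with
  | lit L hL =>
    cases L with
    | pos x => exact fun h => hPQ _ hL (atom_iff.1 h)
    | neg x =>
      intro h
      obtain ⟨y, hy, -, hQ⟩ := imp_iff.1 h
      cases hy
      exact hPQ _ hL hQ
  | and φ ψ _ _ ih _ => exact fun h => ih (and_iff.1 h).1
  | or φ ψ _ _ ih _ => exact fun h => ih (or_iff.1 h).1

theorem disj : ∀ l : List Formula, l ≠ [] → (∀ φ ∈ l, SideFormula P φ) →
    SideFormula P (Formula.disj l)
  | [], h, _ => absurd rfl h
  | [φ], _, h => h φ (by simp)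
  | φ :: ψ :: l, _, h => or _ _ (h φ (by simp))
      (disj (ψ :: l) (by simp) fun χ hχ => h χ (List.mem_cons_of_mem _ hχ))

theorem conj : ∀ l : List Formula, l ≠ [] → (∀ φ ∈ l, SideFormula P φ) →
    SideFormula P (Formula.conj l)
  | [], h, _ => absurd rfl h
  | [φ], _, h => h φ (by simp)
  | φ :: ψ :: l, _, h => and _ _ (h φ (by simp))
      (conj (ψ :: l) (by simp) fun χ hχ => h χ (List.mem_cons_of_mem _ hχ))

/-- Nonemptiness is essential: the empty conjunction and disjunction are `⊤` and `⊥`, which are not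
side formulas. -/
theorem cnfFormula {𝒞 : List Clause} (h𝒞 : 𝒞 ≠ []) (hne : ∀ C ∈ 𝒞, C ≠ [])
    (hP : ∀ C ∈ 𝒞, ∀ L ∈ C, P L) : SideFormula P (cnfFormula 𝒞) := by
  refine conj _ (by simpa using h𝒞) ?_
  intro φ hφ
  obtain ⟨C, hC, rfl⟩ := List.mem_map.1 hφ
  refine disj _ (by simpa using hne C hC) ?_
  intro ψ hψ
  obtain ⟨L, hL, rfl⟩ := List.mem_map.1 hψ
  exact lit L (hP C hC L hL)

end SideFormula

/-! ### Truth values of conjunctions of clauses. -/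

theorem Formula.eval_conj (v : ℕ → Bool) : ∀ l : List Formula,
    (Formula.conj l).eval v = true ↔ ∀ φ ∈ l, φ.eval v = true
  | [] => by simp [Formula.conj, Formula.eval]
  | [φ] => by simp [Formula.conj]
  | φ :: ψ :: l => by
    rw [Formula.conj, Formula.eval, Bool.and_eq_true, Formula.eval_conj v (ψ :: l)]
    simp

theorem Formula.eval_disj (v : ℕ → Bool) : ∀ l : List Formula,
    (Formula.disj l).eval v = true ↔ ∃ φ ∈ l, φ.eval v = true
  | [] => by simp [Formula.disj, Formula.eval]
  | [φ] => by simp [Formula.disj]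
  | φ :: ψ :: l => by
    rw [Formula.disj, Formula.eval, Bool.or_eq_true, Formula.eval_disj v (ψ :: l)]
    simp

theorem Literal.eval_toFormula (v : ℕ → Bool) (L : Literal) :
    L.toFormula.eval v = L.eval v := by
  cases L <;> simp [Literal.toFormula, Literal.eval, Formula.neg, Formula.eval]

theorem eval_cnfFormula (v : ℕ → Bool) (𝒞 : List Clause) :
    (cnfFormula 𝒞).eval v = true ↔ ∀ C ∈ 𝒞, Clause.Holds v C := by
  simp [cnfFormula, Formula.eval_conj, Clause.toFormula, Formula.eval_disj, Clause.Holds,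
    Literal.eval_toFormula]

/-! ### Rectangles of sequents -/

/-- The inputs that falsify the part of the sequent consisting of literals with property `P`. -/
def sequentSet {X : Type} (P : Literal → Prop) (v : X → ℕ → Bool) (S : Sequent) : Set X :=
  {a | (∀ φ ∈ S.ant, SideFormula P φ → φ.eval (v a) = true) ∧ Formula.bot ∉ S.ant ∧
    ∀ x, Formula.atom x ∈ S.suc → P (Literal.neg x) → v a x = false}

section Sequents

variable {X : Type} {P : Literal → Prop} {v : X → ℕ → Bool} {Γ Δ : List Formula} {φ : Formula}
  {a : X}

theorem sequentSet_anti {S S' : Sequent} (hant : ∀ φ ∈ S'.ant, φ ∈ S.ant)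
    (hsuc : ∀ φ ∈ S'.suc, φ ∈ S.suc) : sequentSet P v S ⊆ sequentSet P v S' :=
  fun _ h => ⟨fun φ hφ => h.1 φ (hant φ hφ), fun hb => h.2.1 (hant _ hb),
    fun x hx => h.2.2 x (hsuc _ hx)⟩

theorem mem_sequentSet_ant : a ∈ sequentSet P v ⟨Γ ++ [φ], Δ⟩ ↔
    a ∈ sequentSet P v ⟨Γ, Δ⟩ ∧ (SideFormula P φ → φ.eval (v a) = true) ∧ φ ≠ Formula.bot := by
  simp only [sequentSet, Set.mem_ofPred_eq, List.mem_append, List.mem_singleton, or_imp,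
    forall_and, forall_eq, not_or]
  constructor
  · rintro ⟨⟨h1, h2⟩, ⟨h3, h4⟩, h5⟩
    exact ⟨⟨h1, h3, h5⟩, h2, fun h => h4 h.symm⟩
  · rintro ⟨⟨h1, h3, h5⟩, h2, h4⟩
    exact ⟨⟨h1, h2⟩, ⟨h3, fun h => h4 h.symm⟩, h5⟩

theorem mem_sequentSet_suc : a ∈ sequentSet P v ⟨Γ, φ :: Δ⟩ ↔
    a ∈ sequentSet P v ⟨Γ, Δ⟩ ∧
      ∀ x, φ = Formula.atom x → P (Literal.neg x) → v a x = false := by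
  simp only [sequentSet, Set.mem_ofPred_eq, List.mem_cons, or_imp, forall_and]
  constructor
  · rintro ⟨h1, h2, h3, h4⟩
    exact ⟨⟨h1, h2, h4⟩, fun x hx => h3 x hx.symm⟩
  · rintro ⟨⟨h1, h2, h4⟩, h3⟩
    exact ⟨h1, h2, fun x hx => h3 x hx.symm, h4⟩

/-- The sequents that can occur in a cut-free proof of `α → ¬ β`. -/
def Relevant (α β : Formula) (S : Sequent) : Prop :=
  (∀ φ ∈ S.ant, SideFormula CliqueSide φ ∨ SideFormula ColorSide φ ∨ φ = Formula.bot) ∧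
  ∀ φ ∈ S.suc, (∃ x, φ = Formula.atom x) ∨ φ = Formula.bot ∨ φ = β.neg ∨ φ = α.imp β.neg

variable {α β : Formula}

theorem Relevant.anti {S S' : Sequent} (h : Relevant α β S) (hant : ∀ φ ∈ S'.ant, φ ∈ S.ant)
    (hsuc : ∀ φ ∈ S'.suc, φ ∈ S.suc) : Relevant α β S' :=
  ⟨fun φ hφ => h.1 φ (hant φ hφ), fun φ hφ => h.2 φ (hsuc φ hφ)⟩

theorem relevant_ant : Relevant α β ⟨Γ ++ [φ], Δ⟩ ↔ Relevant α β ⟨Γ, Δ⟩ ∧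
    (SideFormula CliqueSide φ ∨ SideFormula ColorSide φ ∨ φ = Formula.bot) := by
  simp only [Relevant, List.mem_append, List.mem_singleton, or_imp, forall_and, forall_eq]
  tauto

theorem relevant_suc : Relevant α β ⟨Γ, φ :: Δ⟩ ↔ Relevant α β ⟨Γ, Δ⟩ ∧
    ((∃ x, φ = Formula.atom x) ∨ φ = Formula.bot ∨ φ = β.neg ∨ φ = α.imp β.neg) := by
  simp only [Relevant, List.mem_cons, or_imp, forall_and, forall_eq]
  tauto

theorem SideFormula.not_color (h : SideFormula CliqueSide φ) : ¬ SideFormula ColorSide φ :=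
  h.disjoint fun _ h1 h2 => h2 h1

theorem SideFormula.not_clique (h : SideFormula ColorSide φ) : ¬ SideFormula CliqueSide φ :=
  h.disjoint fun _ h1 h2 => h1 h2

variable {k m l : ℕ} [NeZero l]

/-- The rectangle of the pairs that falsify a sequent. -/
noncomputable def sequentRect (k m l : ℕ) [NeZero l] (S : Sequent) :
    Set (Fin k → Fin m) × Set (Fin k × Fin m → Fin l) :=
  (sequentSet CliqueSide cliqueAssign S, sequentSet ColorSide colorAssign S)

/-- For an edge atom, the left occurrence is read by the clique input and the right one by the
coloring input, which gives an edge rectangle. Both occurrences of a `q`- or `r`-atom are read by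
the same input, so one side is empty. The formula `⊥` empties the clique side, and `¬ β` empties the
coloring side because `β` holds at every coloring. -/
theorem covers_axiom {s t : ℕ} (hs : 2 ≤ s)
    (hβ : ∀ b : Fin k × Fin m → Fin l, β.eval (colorAssign b) = true)
    (hβc : SideFormula ColorSide β)
    {T : Set (Set (Fin k → Fin m) × Set (Fin k × Fin m → Fin l))} (h : Covers s t T)
    (hS : Relevant α β ⟨[φ], [φ]⟩) : Covers s t (insert (sequentRect k m l ⟨[φ], [φ]⟩) T) := by
  have hant := hS.1 φ (by simp)
  by_cases hbot : φ = Formula.bot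
  · have : sequentSet CliqueSide cliqueAssign ⟨[φ], [φ]⟩ = (∅ : Set (Fin k → Fin m)) :=
      Set.eq_empty_of_forall_notMem fun a ha => ha.2.1 (by simp [hbot])
    rw [sequentRect, this]
    exact h.left_empty
  have hleft : ∀ a : Fin k → Fin m, a ∈ sequentSet CliqueSide cliqueAssign ⟨[φ], [φ]⟩ →
      SideFormula CliqueSide φ → φ.eval (cliqueAssign a) = true :=
    fun a ha => ha.1 φ (by simp)
  have hright : ∀ b : Fin k × Fin m → Fin l, b ∈ sequentSet ColorSide colorAssign ⟨[φ], [φ]⟩ →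
      SideFormula ColorSide φ → φ.eval (colorAssign b) = true :=
    fun b hb => hb.1 φ (by simp)
  rcases hS.2 φ (by simp) with ⟨x, rfl⟩ | hφ | hφ | hφ
  · by_cases h0 : x % 3 = 0
    · refine h.edgeAtom hs h0 (fun a ha => hleft a ha ?_) fun b hb => hb.2.2 x (by simp) ?_
      · exact SideFormula.atom_iff.2 (by simp [CliqueSide, h0])
      · simp [ColorSide, CliqueSide, h0]
    · by_cases h1 : x % 3 = 1
      · have : sequentSet CliqueSide cliqueAssign ⟨[Formula.atom x], [Formula.atom x]⟩ =
            (∅ : Set (Fin k → Fin m)) := by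
          refine Set.eq_empty_of_forall_notMem fun a ha => ?_
          have h2 := hleft a ha (SideFormula.atom_iff.2 (by simp [CliqueSide, h1]))
          have h3 := ha.2.2 x (by simp) (by simp [CliqueSide, h1])
          simp [Formula.eval, h3] at h2
        rw [sequentRect, this]
        exact h.left_empty
      · have : sequentSet ColorSide colorAssign ⟨[Formula.atom x], [Formula.atom x]⟩ =
            (∅ : Set (Fin k × Fin m → Fin l)) := by
          refine Set.eq_empty_of_forall_notMem fun b hb => ?_
          have h2 := hright b hb (SideFormula.atom_iff.2 (by
            simp only [ColorSide, CliqueSide]; omega))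
          have h3 := hb.2.2 x (by simp) (by simp [ColorSide, CliqueSide, h1])
          simp [Formula.eval, h3] at h2
        rw [sequentRect, this]
        exact h.right_empty
  · exact absurd hφ hbot
  · have : sequentSet ColorSide colorAssign ⟨[φ], [φ]⟩ =
        (∅ : Set (Fin k × Fin m → Fin l)) := by
      refine Set.eq_empty_of_forall_notMem fun b hb => ?_
      subst hφ
      rcases hant with h1 | h1 | h1
      -- If `¬ β` were on the clique side, `β` would be a `q`-atom, contrary to `hβc`.
      · obtain ⟨x, rfl, -, hx⟩ := SideFormula.imp_iff.1 h1
        have h2 := SideFormula.atom_iff.1 hβc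
        simp only [ColorSide, CliqueSide] at h2 hx
        omega
      · have h2 := hright b hb h1
        simp [Formula.neg, Formula.eval, hβ b] at h2
      · exact hbot h1
    rw [sequentRect, this]
    exact h.right_empty
  · subst hφ
    rcases hant with h1 | h1 | h1
    · obtain ⟨x, -, hx, -⟩ := SideFormula.imp_iff.1 h1
      cases hx
    · obtain ⟨x, -, hx, -⟩ := SideFormula.imp_iff.1 h1
      cases hx
    · exact absurd h1 hbot

/-- A step of a cut-free proof costs at most one gate. -/
theorem covers_lkStep {s t : ℕ} (hs : 2 ≤ s)
    (hα : ∀ a : Fin k → Fin m, α.eval (cliqueAssign a) = true)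
    (hβ : ∀ b : Fin k × Fin m → Fin l, β.eval (colorAssign b) = true)
    (hαc : SideFormula CliqueSide α) (hβc : SideFormula ColorSide β)
    {T : Set (Set (Fin k → Fin m) × Set (Fin k × Fin m → Fin l))} (h : Covers s t T)
    {Θ : Set Sequent} (hΘ : ∀ S ∈ Θ, Relevant α β S → sequentRect k m l S ∈ T)
    {S : Sequent} (hstep : LKStep Θ S) (hS : Relevant α β S) :
    Covers s (t + 1) (insert (sequentRect k m l S) T) := by
  -- Among the rules that can yield a relevant sequent, only `∨` on the left needs a gate; for the
  -- others the rectangle lies inside that of one premise.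
  have hweak : ∀ S' ∈ Θ, Relevant α β S' →
      sequentSet CliqueSide cliqueAssign S ⊆
        (sequentSet CliqueSide cliqueAssign S' : Set (Fin k → Fin m)) →
      sequentSet ColorSide colorAssign S ⊆
        (sequentSet ColorSide colorAssign S' : Set (Fin k × Fin m → Fin l)) →
      Covers s (t + 1) (insert (sequentRect k m l S) T) := fun S' h' hr hA hB =>
    (h.weaken (hΘ S' h' hr) hA hB).mono (Nat.le_succ t) subset_rfl
  have hstruct : ∀ S' ∈ Θ, (∀ φ ∈ S'.ant, φ ∈ S.ant) → (∀ φ ∈ S'.suc, φ ∈ S.suc) →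
      Covers s (t + 1) (insert (sequentRect k m l S) T) := fun S' h' h1 h2 =>
    hweak S' h' (hS.anti h1 h2) (sequentSet_anti h1 h2) (sequentSet_anti h1 h2)
  cases hstep with
  | ax φ => exact (covers_axiom hs hβ hβc h hS).mono (Nat.le_succ t) subset_rfl
  | axBot =>
    have : sequentSet CliqueSide cliqueAssign ⟨[Formula.bot], []⟩ = (∅ : Set (Fin k → Fin m)) :=
      Set.eq_empty_of_forall_notMem fun a ha => ha.2.1 (by simp)
    rw [sequentRect, this]
    exact h.left_empty.mono (Nat.le_succ t) subset_rfl
  | axTop =>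
    have := hS.2 Formula.top (by simp)
    simp [Formula.neg] at this
  | exchangeL Γ Θ Δ φ ψ h' =>
    exact hstruct _ h' (by simp; tauto) (by simp)
  | exchangeR Γ Δ Λ φ ψ h' =>
    exact hstruct _ h' (by simp) (by simp; tauto)
  | weakL Γ Δ φ h' => exact hstruct _ h' (by simp; tauto) (by simp)
  | weakR Γ Δ φ h' => exact hstruct _ h' (by simp) (by simp; tauto)
  | contrL Γ Δ φ h' => exact hstruct _ h' (by simp) (by simp)
  | contrR Γ Δ φ h' => exact hstruct _ h' (by simp) (by simp)
  | andL₁ Γ Δ φ ψ h' =>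
    obtain ⟨hr, hside⟩ := relevant_ant.1 hS
    have hside : SideFormula CliqueSide (φ.and ψ) ∨ SideFormula ColorSide (φ.and ψ) := by
      simpa using hside
    rw [SideFormula.and_iff, SideFormula.and_iff] at hside
    refine hweak _ h' (relevant_ant.2 ⟨hr, by tauto⟩) ?_ ?_ <;> intro a ha <;>
      rw [mem_sequentSet_ant, SideFormula.and_iff, Formula.eval, Bool.and_eq_true] at ha <;>
      refine mem_sequentSet_ant.2 ⟨ha.1, fun hφ => ?_, ?_⟩
    · rcases hside with h1 | h1
      · exact (ha.2.1 h1).1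
      · exact absurd hφ h1.1.not_clique
    · rintro rfl
      rcases hside with h1 | h1 <;> exact SideFormula.not_bot h1.1
    · rcases hside with h1 | h1
      · exact absurd hφ h1.1.not_color
      · exact (ha.2.1 h1).1
    · rintro rfl
      rcases hside with h1 | h1 <;> exact SideFormula.not_bot h1.1
  | andL₂ Γ Δ φ ψ h' =>
    obtain ⟨hr, hside⟩ := relevant_ant.1 hS
    have hside : SideFormula CliqueSide (φ.and ψ) ∨ SideFormula ColorSide (φ.and ψ) := by
      simpa using hside
    rw [SideFormula.and_iff, SideFormula.and_iff] at hside
    refine hweak _ h' (relevant_ant.2 ⟨hr, by tauto⟩) ?_ ?_ <;> intro a ha <;>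
      rw [mem_sequentSet_ant, SideFormula.and_iff, Formula.eval, Bool.and_eq_true] at ha <;>
      refine mem_sequentSet_ant.2 ⟨ha.1, fun hφ => ?_, ?_⟩
    · rcases hside with h1 | h1
      · exact (ha.2.1 h1).2
      · exact absurd hφ h1.2.not_clique
    · rintro rfl
      rcases hside with h1 | h1 <;> exact SideFormula.not_bot h1.2
    · rcases hside with h1 | h1
      · exact absurd hφ h1.2.not_color
      · exact (ha.2.1 h1).2
    · rintro rfl
      rcases hside with h1 | h1 <;> exact SideFormula.not_bot h1.2
  | andR Γ Δ φ ψ h₁ h₂ =>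
    have := (relevant_suc.1 hS).2
    simp [Formula.neg] at this
  | orL Γ Δ φ ψ h₁ h₂ =>
    obtain ⟨hr, hside⟩ := relevant_ant.1 hS
    have hside : SideFormula CliqueSide (φ.or ψ) ∨ SideFormula ColorSide (φ.or ψ) := by
      simpa using hside
    rw [SideFormula.or_iff, SideFormula.or_iff] at hside
    have hR₁ := hΘ _ h₁ (relevant_ant.2 ⟨hr, by tauto⟩)
    have hR₂ := hΘ _ h₂ (relevant_ant.2 ⟨hr, by tauto⟩)
    have hφ : φ ≠ Formula.bot := by
      rintro rfl
      rcases hside with h1 | h1 <;> exact SideFormula.not_bot h1.1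
    have hψ : ψ ≠ Formula.bot := by
      rintro rfl
      rcases hside with h1 | h1 <;> exact SideFormula.not_bot h1.2
    -- Inputs on the side of the disjunction make one disjunct true and so split between the
    -- premises; inputs on the other side ignore the formula and falsify both premises.
    rcases hside with hside | hside
    · refine h.or hR₁ hR₂ ?_ ?_ ?_ <;> intro a ha <;>
        rw [mem_sequentSet_ant, SideFormula.or_iff, Formula.eval, Bool.or_eq_true] at ha
      · rcases ha.2.1 hside with h1 | h1
        · exact Or.inl (mem_sequentSet_ant.2 ⟨ha.1, fun _ => h1, hφ⟩)
        · exact Or.inr (mem_sequentSet_ant.2 ⟨ha.1, fun _ => h1, hψ⟩)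
      · exact mem_sequentSet_ant.2 ⟨ha.1, fun h1 => absurd h1 hside.1.not_color, hφ⟩
      · exact mem_sequentSet_ant.2 ⟨ha.1, fun h1 => absurd h1 hside.2.not_color, hψ⟩
    · refine h.and hR₁ hR₂ ?_ ?_ ?_ <;> intro a ha <;>
        rw [mem_sequentSet_ant, SideFormula.or_iff, Formula.eval, Bool.or_eq_true] at ha
      · exact mem_sequentSet_ant.2 ⟨ha.1, fun h1 => absurd h1 hside.1.not_clique, hφ⟩
      · exact mem_sequentSet_ant.2 ⟨ha.1, fun h1 => absurd h1 hside.2.not_clique, hψ⟩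
      · rcases ha.2.1 hside with h1 | h1
        · exact Or.inl (mem_sequentSet_ant.2 ⟨ha.1, fun _ => h1, hφ⟩)
        · exact Or.inr (mem_sequentSet_ant.2 ⟨ha.1, fun _ => h1, hψ⟩)
  | orR₁ Γ Δ φ ψ h' =>
    have := (relevant_suc.1 hS).2
    simp [Formula.neg] at this
  | orR₂ Γ Δ φ ψ h' =>
    have := (relevant_suc.1 hS).2
    simp [Formula.neg] at this
  | impL Γ Δ φ ψ h₁ h₂ =>
    obtain ⟨hr, hside⟩ := relevant_ant.1 hS
    -- A relevant implication on the left is a negated atom, so the left premise, with the atom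
    -- moved to the right, is all that is needed.
    obtain ⟨x, rfl, rfl⟩ : ∃ x, φ = Formula.atom x ∧ ψ = Formula.bot := by
      rw [SideFormula.imp_iff, SideFormula.imp_iff] at hside
      rcases hside with ⟨x, h1, h2, -⟩ | ⟨x, h1, h2, -⟩ | h1
      exacts [⟨x, h1, h2⟩, ⟨x, h1, h2⟩, by cases h1]
    have key : ∀ {X : Type} {P : Literal → Prop} {v : X → ℕ → Bool},
        sequentSet P v ⟨Γ ++ [(Formula.atom x).imp Formula.bot], Δ⟩ ⊆
          sequentSet P v ⟨Γ, Formula.atom x :: Δ⟩ := by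
      intro X P v a ha
      rw [mem_sequentSet_ant] at ha
      refine mem_sequentSet_suc.2 ⟨ha.1, ?_⟩
      rintro y hy hP
      cases hy
      simpa [Formula.eval] using ha.2.1 (SideFormula.imp_iff.2 ⟨x, rfl, rfl, hP⟩)
    exact hweak _ h₁ (relevant_suc.2 ⟨hr, Or.inl ⟨x, rfl⟩⟩) key key
  | impR Γ Δ φ ψ h' =>
    obtain ⟨hr, hside⟩ := relevant_suc.1 hS
    -- The formula that enters the antecedent is `β` or `α`, which is true at all test inputs of its
    -- own side and ignored by the other, so no input is lost.
    have hside : (φ = β ∧ ψ = Formula.bot) ∨ (φ = α ∧ ψ = β.neg) := by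
      simpa [Formula.neg] using hside
    rcases hside with ⟨rfl, rfl⟩ | ⟨rfl, rfl⟩
    · refine hweak _ h' (relevant_ant.2 ⟨relevant_suc.2 ⟨hr, Or.inr (Or.inl rfl)⟩,
        Or.inr (Or.inl hβc)⟩) ?_ ?_ <;> intro a ha <;> rw [mem_sequentSet_suc] at ha <;>
        refine mem_sequentSet_ant.2 ⟨mem_sequentSet_suc.2 ⟨ha.1, by simp⟩, ?_, ?_⟩
      · exact fun h1 => absurd h1 hβc.not_clique
      · rintro rfl
        exact SideFormula.not_bot hβc
      · exact fun _ => hβ a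
      · rintro rfl
        exact SideFormula.not_bot hβc
    · refine hweak _ h' (relevant_ant.2 ⟨relevant_suc.2 ⟨hr, Or.inr (Or.inr (Or.inl rfl))⟩,
        Or.inl hαc⟩) ?_ ?_ <;> intro a ha <;> rw [mem_sequentSet_suc] at ha <;>
        refine mem_sequentSet_ant.2 ⟨mem_sequentSet_suc.2 ⟨ha.1, by simp [Formula.neg]⟩, ?_, ?_⟩
      · exact fun _ => hα a
      · rintro rfl
        exact SideFormula.not_bot hαc
      · exact fun h1 => absurd h1 hαc.not_color
      · rintro rfl
        exact SideFormula.not_bot hαc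

/-- Cut-free proofs of `α → ¬ β` are long. -/
theorem two_pow_le_length_of_isCutFreeProof {s : ℕ} (hs : 2 ≤ s) (hm : 4 * s ≤ m)
    (hl : 2 * (s * s) ≤ l) (hα : ∀ a : Fin k → Fin m, α.eval (cliqueAssign a) = true)
    (hβ : ∀ b : Fin k × Fin m → Fin l, β.eval (colorAssign b) = true)
    (hαc : SideFormula CliqueSide α) (hβc : SideFormula ColorSide β)
    {π : List Sequent} (hπ : IsCutFreeProof π (α.imp β.neg)) : 2 ^ s ≤ π.length := by
  -- Irrelevant sequents are skipped: the premises used by the step into a relevant sequent are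
  -- relevant themselves.
  have key : ∀ σ τ, π = σ ++ τ → Covers s σ.length
      {R | ∃ S ∈ σ, Relevant α β S ∧ sequentRect k m l S = R} := by
    intro σ
    induction σ using List.reverseRecOn with
    | nil => intro τ _; exact Covers.empty.mono le_rfl (by simp)
    | append_singleton σ S ih =>
      intro τ hτ
      rw [List.append_assoc, List.singleton_append] at hτ
      have h := ih _ hτ
      by_cases hS : Relevant α β S
      · have h1 := covers_lkStep hs hα hβ hαc hβc h (Θ := {T | T ∈ σ})
          (fun S' hS' hr => ⟨S', hS', hr, rfl⟩) (hπ.1 σ τ S hτ) hS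
        refine h1.mono (by simp) ?_
        rintro R ⟨S', hS', hr, rfl⟩
        rcases List.mem_append.1 hS' with h2 | h2
        · exact Or.inr ⟨S', h2, hr, rfl⟩
        · rw [List.mem_singleton.1 h2]
          exact Or.inl rfl
      · refine h.mono (by simp) ?_
        rintro R ⟨S', hS', hr, rfl⟩
        rcases List.mem_append.1 hS' with h2 | h2
        · exact ⟨S', h2, hr, rfl⟩
        · rw [List.mem_singleton.1 h2] at hr
          exact absurd hr hS
  refine (key π [] (by simp)).two_pow_le ⟨_, List.mem_of_getLast? hπ.2, ?_, ?_⟩ (by omega)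
    (by simpa using hm) (by simpa using hl)
  · simp [Relevant]
  · ext a <;> simp [sequentRect, sequentSet]

end Sequents

/-! ### Rectangles of clauses -/

/-- The inputs that falsify all literals of the clause with property `P`. -/
def clauseSet {X : Type} (P : Literal → Prop) (v : X → ℕ → Bool) (C : Clause) : Set X :=
  {a | ∀ L ∈ C, P L → L.eval (v a) = false}

section Clauses

variable {k m l : ℕ} [NeZero l]

/-- The rectangle of the pairs that falsify a clause. -/
noncomputable def clauseRect (k m l : ℕ) [NeZero l] (C : Clause) :
    Set (Fin k → Fin m) × Set (Fin k × Fin m → Fin l) :=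
  (clauseSet CliqueSide cliqueAssign C, clauseSet ColorSide colorAssign C)

theorem clauseSet_eq_empty {X : Type} {P : Literal → Prop} {v : X → ℕ → Bool} {C : Clause}
    (hP : ∀ L ∈ C, P L) (hv : ∀ a, Clause.Holds (v a) C) : clauseSet P v C = ∅ := by
  refine Set.eq_empty_of_forall_notMem fun a ha => ?_
  obtain ⟨L, hL, h⟩ := hv a
  rw [ha L hL (hP L hL)] at h
  cases h

/-- A resolution step costs at most two gates. -/
theorem covers_resolvent {s t : ℕ} (hs : 2 ≤ s)
    {T : Set (Set (Fin k → Fin m) × Set (Fin k × Fin m → Fin l))} (h : Covers s t T)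
    {C₁ C₂ E : Clause} (h₁ : clauseRect k m l C₁ ∈ T) (h₂ : clauseRect k m l C₂ ∈ T)
    (hE : Clause.IsResolvent C₁ C₂ E) :
    Covers s (t + 2) (insert (clauseRect k m l E) T) := by
  obtain ⟨x, C, D, hC₁, hC₂, hE⟩ := hE
  have hpos : ∀ L ∈ C₁, L ∈ E ∨ L = Literal.pos x := by
    intro L hL
    have h1 : L ∈ C ∪ {Literal.pos x} := hC₁ ▸ hL
    rcases h1 with h1 | h1
    · have h2 : L ∈ C ∪ D := Or.inl h1
      rw [← hE] at h2
      exact Or.inl h2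
    · exact Or.inr h1
  have hneg : ∀ L ∈ C₂, L ∈ E ∨ L = Literal.neg x := by
    intro L hL
    have h1 : L ∈ D ∪ {Literal.neg x} := hC₂ ▸ hL
    rcases h1 with h1 | h1
    · have h2 : L ∈ C ∪ D := Or.inr h1
      rw [← hE] at h2
      exact Or.inl h2
    · exact Or.inr h1
  have hA : ∀ {X : Type} {P : Literal → Prop} {v : X → ℕ → Bool} {a : X}, a ∈ clauseSet P v E →
      (P (Literal.pos x) → v a x = false) → a ∈ clauseSet P v C₁ := by
    intro X P v a ha hx L hL hP
    rcases hpos L hL with h1 | rfl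
    · exact ha L h1 hP
    · exact hx hP
  have hB : ∀ {X : Type} {P : Literal → Prop} {v : X → ℕ → Bool} {a : X}, a ∈ clauseSet P v E →
      (P (Literal.neg x) → v a x = true) → a ∈ clauseSet P v C₂ := by
    intro X P v a ha hx L hL hP
    rcases hneg L hL with h1 | rfl
    · exact ha L h1 hP
    · simpa [Literal.eval] using hx hP
  -- For a `q`-pivot the clique inputs split by the value of the pivot and the colorings falsify
  -- both premises; an `r`-pivot is dual. An edge pivot puts its two literals on different sides.
  obtain h0 | h1 | h2 : x % 3 = 0 ∨ x % 3 = 1 ∨ x % 3 = 2 := by omega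
  · have hcp : CliqueSide (Literal.pos x) := by simp [CliqueSide, h0]
    have hcn : ¬ CliqueSide (Literal.neg x) := by simp [CliqueSide, h0]
    have e1 := h.edgeAtom hs h0 (A := {a | cliqueAssign a x = true})
      (B := {b | colorAssign b x = false}) (fun _ ha => ha) (fun _ hb => hb)
    -- The first gate joins `C₁` with the edge rectangle, keeping all transversals but only the
    -- colorings with `x` false. The second gate adds the remaining colorings through `C₂`.
    have e2 := e1.or (A := clauseSet CliqueSide cliqueAssign E)
      (B := clauseSet ColorSide colorAssign E ∩ {b | colorAssign b x = false})
      (Or.inr h₁) (Or.inl rfl) (by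
        intro a ha
        by_cases hx : cliqueAssign a x = true
        · exact Or.inr hx
        · exact Or.inl (hA ha fun _ => by simpa using hx))
      (fun b hb => hA hb.1 fun h => absurd hcp h) (fun b hb => hb.2)
    have e3 := e2.and (A := clauseSet CliqueSide cliqueAssign E)
      (B := clauseSet ColorSide colorAssign E) (Or.inl rfl) (Or.inr (Or.inr h₂)) subset_rfl
      (fun a ha => hB ha fun h => absurd h hcn) (by
        intro b hb
        by_cases hx : colorAssign b x = true
        · exact Or.inr (hB hb fun _ => hx)
        · exact Or.inl ⟨hb, by simpa using hx⟩)
    exact e3.mono le_rfl (Set.insert_subset_insert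
      ((Set.subset_insert _ _).trans (Set.subset_insert _ _)))
  · have hcp : CliqueSide (Literal.pos x) := by simp [CliqueSide, h1]
    have hcn : CliqueSide (Literal.neg x) := by simp [CliqueSide, h1]
    refine (h.or h₁ h₂ ?_ ?_ ?_).mono (Nat.le_succ _) subset_rfl
    · intro a ha
      by_cases hx : cliqueAssign a x = true
      · exact Or.inr (hB ha fun _ => hx)
      · exact Or.inl (hA ha fun _ => by simpa using hx)
    · exact fun b hb => hA hb fun h => absurd hcp h
    · exact fun b hb => hB hb fun h => absurd hcn h
  · have hcp : ¬ CliqueSide (Literal.pos x) := by simp [CliqueSide, h2]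
    have hcn : ¬ CliqueSide (Literal.neg x) := by simp [CliqueSide, h2]
    refine (h.and h₁ h₂ ?_ ?_ ?_).mono (Nat.le_succ _) subset_rfl
    · exact fun b hb => hA hb fun h => absurd h hcp
    · exact fun b hb => hB hb fun h => absurd h hcn
    · intro b hb
      by_cases hx : colorAssign b x = true
      · exact Or.inr (hB hb fun _ => hx)
      · exact Or.inl (hA hb fun _ => by simpa using hx)

/-- Resolution refutations of a clique part and a coloring part are long. -/
theorem two_pow_le_length_of_isRefutation {s : ℕ} (hs : 2 ≤ s) (hm : 4 * s ≤ m)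
    (hl : 2 * (s * s) ≤ l) {𝒞 𝒟 : List Clause}
    (h𝒞 : ∀ C ∈ 𝒞, ∀ L ∈ C, CliqueSide L) (h𝒟 : ∀ C ∈ 𝒟, ∀ L ∈ C, ColorSide L)
    (h𝒞v : ∀ a : Fin k → Fin m, ∀ C ∈ 𝒞, Clause.Holds (cliqueAssign a) C)
    (h𝒟v : ∀ b : Fin k × Fin m → Fin l, ∀ C ∈ 𝒟, Clause.Holds (colorAssign b) C)
    {π : List Clause} (hπ : IsRefutation π (𝒞 ++ 𝒟)) : 2 ^ s ≤ 2 * π.length := by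
  have key : ∀ σ τ, π = σ ++ τ → Covers s (2 * σ.length)
      {R | ∃ C ∈ σ, clauseRect k m l C = R} := by
    intro σ
    induction σ using List.reverseRecOn with
    | nil => intro τ _; exact Covers.empty.mono le_rfl (by simp)
    | append_singleton σ E ih =>
      intro τ hτ
      rw [List.append_assoc, List.singleton_append] at hτ
      have h := ih _ hτ
      have h1 : Covers s (2 * σ.length + 2) (insert (clauseRect k m l E)
          {R | ∃ C ∈ σ, clauseRect k m l C = R}) := by
        rcases hπ.1 σ τ E hτ with hE | ⟨C₁, hC₁, C₂, hC₂, hE⟩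
        · rcases List.mem_append.1 hE with hE | hE
          · rw [clauseRect, clauseSet_eq_empty (h𝒞 E hE) fun a => h𝒞v a E hE]
            exact h.left_empty.mono (by omega) subset_rfl
          · rw [clauseRect, clauseSet_eq_empty (h𝒟 E hE) fun b => h𝒟v b E hE]
            exact h.right_empty.mono (by omega) subset_rfl
        · exact covers_resolvent hs h ⟨C₁, hC₁, rfl⟩ ⟨C₂, hC₂, rfl⟩ hE
      refine h1.mono (by simp; omega) ?_
      rintro R ⟨C, hC, rfl⟩
      rcases List.mem_append.1 hC with h2 | h2
      · exact Or.inr ⟨C, h2, rfl⟩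
      · rw [List.mem_singleton.1 h2]
        exact Or.inl rfl
  refine (key π [] (by simp)).two_pow_le ⟨_, List.mem_of_getLast? hπ.2, ?_⟩ (by omega)
    (by simpa using hm) (by simpa using hl)
  ext a <;> simp [clauseRect, clauseSet]

end Clauses

/-! ### Parameters -/

/-- With `x = n^(1/3-ε)`, take `s = ⌊x/8⌋` and `m = n / k`. Then `4sk ≤ n^(1/3) * n^(2/3) = n`, and
`2s² ≤ x²/32` is below the number of colors, which is `⌊x²⌋`. -/
theorem parameters {ε : ℝ} {n : ℕ} (h0 : 0 < ε) (h1 : ε < 1 / 3)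
    (hn : (32 : ℝ) ≤ (n : ℝ) ^ (1 / 3 - ε)) :
    ∃ s m : ℕ, 2 ≤ s ∧ 4 * s ≤ m ∧ 2 * (s * s) ≤ ⌊(n : ℝ) ^ (2 / 3 - 2 * ε : ℝ)⌋₊ ∧
      0 < ⌊(n : ℝ) ^ (2 / 3 : ℝ)⌋₊ ∧ ⌊(n : ℝ) ^ (2 / 3 : ℝ)⌋₊ * m ≤ n ∧
      (n : ℝ) ^ (1 / 3 - ε) / 8 ≤ s + 1 := by
  have hn0 : n ≠ 0 := by
    rintro rfl
    rw [Nat.cast_zero, Real.zero_rpow (by linarith)] at hn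
    norm_num at hn
  have hn1 : (1 : ℝ) ≤ n := by exact_mod_cast Nat.one_le_iff_ne_zero.2 hn0
  set x : ℝ := (n : ℝ) ^ (1 / 3 - ε) with hx
  set k := ⌊(n : ℝ) ^ (2 / 3 : ℝ)⌋₊ with hk
  have hk0 : 0 < k := Nat.floor_pos.2 (Real.one_le_rpow hn1 (by norm_num))
  have hs : ((⌊x / 8⌋₊ : ℕ) : ℝ) ≤ x / 8 := Nat.floor_le (by linarith)
  refine ⟨⌊x / 8⌋₊, n / k, Nat.le_floor (by push_cast; linarith), ?_, ?_, hk0, ?_,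
    (Nat.lt_floor_add_one _).le⟩
  · rw [Nat.le_div_iff_mul_le hk0]
    have h2 : (k : ℝ) ≤ (n : ℝ) ^ (2 / 3 : ℝ) := Nat.floor_le (by positivity)
    have h3 : x ≤ (n : ℝ) ^ (1 / 3 : ℝ) := Real.rpow_le_rpow_of_exponent_le hn1 (by linarith)
    have h4 : (n : ℝ) ^ (1 / 3 : ℝ) * (n : ℝ) ^ (2 / 3 : ℝ) = n := by
      rw [← Real.rpow_add (by linarith)]
      norm_num
    have h5 : ((4 * ⌊x / 8⌋₊ * k : ℕ) : ℝ) ≤ n := by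
      push_cast
      calc 4 * (⌊x / 8⌋₊ : ℝ) * k ≤ (n : ℝ) ^ (1 / 3 : ℝ) * (n : ℝ) ^ (2 / 3 : ℝ) :=
            mul_le_mul (by linarith) h2 (by positivity) (by positivity)
        _ = n := h4
    exact_mod_cast h5
  · apply Nat.le_floor
    have h2 : (n : ℝ) ^ (2 / 3 - 2 * ε : ℝ) = x * x := by
      rw [hx, ← Real.rpow_add (by linarith)]
      congr 1
      ring
    rw [h2]
    push_cast
    nlinarith [mul_le_mul hs hs (by positivity) (by linarith)]
  · exact Nat.mul_div_le n k

/-- The threshold 32 is exactly what gives `x/16 + 1 ≤ x/8 - 1 ≤ s`; the two units absorb the factor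
2 and the rounding of `s`. -/
theorem two_rpow_le_of_two_pow_le {x : ℝ} {s N : ℕ} (hx : 32 ≤ x) (hs : x / 8 ≤ s + 1)
    (h : 2 ^ s ≤ 2 * N) : (2 : ℝ) ^ (1 / 16 * x) ≤ N := by
  have h1 : (2 : ℝ) ^ s ≤ 2 * N := by exact_mod_cast h
  have h2 : (2 : ℝ) ^ (1 / 16 * x) * 2 ≤ (2 : ℝ) ^ s := by
    rw [← Real.rpow_natCast, ← Real.rpow_add_one (by norm_num)]
    exact Real.rpow_le_rpow_of_exponent_le (by norm_num) (by linarith)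
  linarith

theorem length_le_length_listCode {α : Type} (c : α → List Bool) (l : List α) :
    l.length ≤ (listCode c l).length := by
  induction l with
  | nil => simp [listCode]
  | cons a l ih =>
    simp only [listCode, List.flatMap_cons, List.length_append, List.length_cons] at ih ⊢
    omega

theorem eventually_le_rpow {δ : ℝ} (hδ : 0 < δ) (M : ℝ) :
    ∃ N : ℕ, ∀ n : ℕ, N ≤ n → M ≤ (n : ℝ) ^ δ :=
  Filter.eventually_atTop.1
    (((tendsto_rpow_atTop hδ).comp tendsto_natCast_atTop_atTop).eventually_ge_atTop M)

/-! ### The two exponential lower bounds. -/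

theorem exists_lkMinus_lower_bound {ε : ℝ} (h0 : 0 < ε) (h1 : ε < 1 / 3) :
    ∃ c : ℝ, 0 < c ∧ ∃ N : ℕ, ∀ n : ℕ, N ≤ n →
      ∀ u : List Bool, LKMinus u (cliqueColorFormula ε n).code →
        (2 : ℝ) ^ (c * (n : ℝ) ^ (1 / 3 - ε)) ≤ (u.length : ℝ) := by
  obtain ⟨N, hN⟩ := eventually_le_rpow (δ := 1 / 3 - ε) (by linarith) 32
  refine ⟨1 / 16, by norm_num, N, fun n hn u hu => ?_⟩
  obtain ⟨π, φ, rfl, hφ, hπ⟩ := hu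
  obtain rfl := Formula.code_selfDelimiting.injective hφ
  obtain ⟨s, m, hs, hm, hl, hk, hkm, hx⟩ := parameters h0 h1 (hN n hn)
  refine two_rpow_le_of_two_pow_le (hN n hn) hx ?_
  have hs1 : 1 ≤ s * s := Nat.mul_pos (by omega) (by omega)
  have hn0 : 0 < n := by
    have : 0 < ⌊(n : ℝ) ^ (2 / 3 : ℝ)⌋₊ * m := Nat.mul_pos hk (by omega)
    omega
  have : NeZero ⌊(n : ℝ) ^ (2 / 3 - 2 * ε : ℝ)⌋₊ := ⟨by omega⟩
  have h2 := two_pow_le_length_of_isCutFreeProof (k := ⌊(n : ℝ) ^ (2 / 3 : ℝ)⌋₊) hs hm hl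
    (fun a => (eval_cnfFormula _ _).2 (holds_cliqueAssign hkm a))
    (fun b => (eval_cnfFormula _ _).2 (holds_colorAssign (n := n) b))
    (SideFormula.cnfFormula
      (List.ne_nil_of_mem (mem_cliqueClauses.2 (Or.inl ⟨0, hk, rfl⟩))) ?_
      fun C hC => cliqueSide_of_mem hC)
    (SideFormula.cnfFormula
      (List.ne_nil_of_mem (mem_colorClauses.2 (Or.inl ⟨0, hn0, rfl⟩))) ?_
      fun C hC => colorSide_of_mem hC) hπ
  · have h3 := length_le_length_listCode Sequent.code π
    rw [lkProofCode]
    omega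
  -- No clause is empty: the long clauses have `n` or `l` literals, and both numbers are positive.
  · intro C hC
    rcases mem_cliqueClauses.1 hC with ⟨u, hu, rfl⟩ | ⟨u, hu, i, hi, j, hj, hne, rfl⟩ |
      ⟨u, hu, w, hw, hne, i, hi, rfl⟩ | ⟨u, hu, w, hw, hne, i, hi, j, hj, hij, rfl⟩ <;>
    simp
    omega
  · intro C hC
    rcases mem_colorClauses.1 hC with ⟨i, hi, rfl⟩ | ⟨i, hi, c, hc, d, hd, hne, rfl⟩ |
      ⟨c, hc, i, hi, j, hj, hij, rfl⟩ <;>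
    simp
    exact Nat.floor_pos.1 (by omega)

theorem exists_resolution_lower_bound {ε : ℝ} (h0 : 0 < ε) (h1 : ε < 1 / 3) :
    ∃ c : ℝ, 0 < c ∧ ∃ N : ℕ, ∀ n : ℕ, N ≤ n →
      ∀ u : List Bool, Resolution u (clausesCode (Clique n ++ Color ε n)) →
        (2 : ℝ) ^ (c * (n : ℝ) ^ (1 / 3 - ε)) ≤ (u.length : ℝ) := by
  obtain ⟨N, hN⟩ := eventually_le_rpow (δ := 1 / 3 - ε) (by linarith) 32
  refine ⟨1 / 16, by norm_num, N, fun n hn u hu => ?_⟩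
  obtain ⟨π, 𝒞, rfl, h𝒞, hπ⟩ := hu
  obtain rfl := clausesCode_selfDelimiting.injective h𝒞
  obtain ⟨s, m, hs, hm, hl, hk, hkm, hx⟩ := parameters h0 h1 (hN n hn)
  refine two_rpow_le_of_two_pow_le (hN n hn) hx ?_
  have hs1 : 1 ≤ s * s := Nat.mul_pos (by omega) (by omega)
  have : NeZero ⌊(n : ℝ) ^ (2 / 3 - 2 * ε : ℝ)⌋₊ := ⟨by omega⟩
  have h2 := two_pow_le_length_of_isRefutation (k := ⌊(n : ℝ) ^ (2 / 3 : ℝ)⌋₊) hs hm hl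
    (fun C hC => cliqueSide_of_mem hC) (fun C hC => colorSide_of_mem hC)
    (holds_cliqueAssign hkm) holds_colorAssign hπ
  have h3 := length_le_length_listCode (listCode Literal.code) π
  rw [clausesCode]
  omega

/-! ### Validity -/

/-- By the pigeonhole principle two members of the clique get the same color. If they are different
vertices, they are joined by an edge, against the coloring; if they coincide, the clique enumeration
is not injective. -/
theorem not_holds_clique_and_color {k l n : ℕ} (hlk : l < k) (v : ℕ → Bool)
    (hq : ∀ C ∈ cliqueClauses k n, Clause.Holds v C)
    (hr : ∀ C ∈ colorClauses l n, Clause.Holds v C) : False := by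
  have h1 : ∀ u : Fin k, ∃ i < n, v (cliqueAtom u i) = true := by
    intro u
    obtain ⟨L, hL, h⟩ := hq _ (mem_cliqueClauses.2 (Or.inl ⟨u, u.isLt, rfl⟩))
    obtain ⟨i, hi, rfl⟩ := List.mem_map.1 hL
    exact ⟨i, List.mem_range.1 hi, h⟩
  have h2 : ∀ i < n, ∃ c : Fin l, v (colorAtom i c) = true := by
    intro i hi
    obtain ⟨L, hL, h⟩ := hr _ (mem_colorClauses.2 (Or.inl ⟨i, hi, rfl⟩))
    obtain ⟨c, hc, rfl⟩ := List.mem_map.1 hL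
    exact ⟨⟨c, List.mem_range.1 hc⟩, h⟩
  choose f hf hqf using h1
  choose g hg using h2
  obtain ⟨u, w, hne, huw⟩ := Fintype.exists_ne_map_eq_of_card_lt
    (fun u : Fin k => g (f u) (hf u)) (by simpa using hlk)
  -- Edge clauses exist only for increasing vertex pairs, so the argument is stated for one order
  -- and used for both.
  have key : ∀ u w : Fin k, u ≠ w → g (f u) (hf u) = g (f w) (hf w) → ¬ f u < f w := by
    intro u w hne huw hlt
    have h3 := hq _ (mem_cliqueClauses.2 (Or.inr (Or.inr (Or.inr ⟨u, u.isLt, w, w.isLt,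
      fun h => hne (Fin.ext h), f u, hf u, f w, hf w, hlt, rfl⟩))))
    have h4 := hr _ (mem_colorClauses.2 (Or.inr (Or.inr ⟨g (f u) (hf u), Fin.isLt _,
      f u, hf u, f w, hf w, hlt, rfl⟩)))
    have h5 := hg (f w) (hf w)
    rw [← huw] at h5
    simp [Clause.Holds, Literal.eval, hqf] at h3
    simp [Clause.Holds, Literal.eval, hg, h5, h3] at h4
  rcases lt_trichotomy (f u) (f w) with h | h | h
  · exact key u w hne huw h
  · have h3 := hq _ (mem_cliqueClauses.2 (Or.inr (Or.inr (Or.inl ⟨u, u.isLt, w, w.isLt,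
      fun h => hne (Fin.ext h), f u, hf u, rfl⟩))))
    have h4 := hqf w
    rw [← h] at h4
    simp [Clause.Holds, Literal.eval, hqf, h4] at h3
  · exact key w u hne.symm huw.symm h

/-! ### Lengths of codes -/

theorem length_listCode_le {α : Type} {c : α → List Bool} {l : List α} {B : ℕ}
    (h : ∀ x ∈ l, (c x).length ≤ B) : (listCode c l).length ≤ l.length * (B + 1) + 1 := by
  induction l with
  | nil => simp [listCode]
  | cons a l ih =>
    have h1 := ih fun x hx => h x (List.mem_cons_of_mem _ hx)
    have h2 := h a (by simp)
    simp only [listCode, List.flatMap_cons, List.length_append, List.length_cons,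
      List.length_nil] at h1 ⊢
    rw [add_mul]
    omega

theorem length_natCode_le (x : ℕ) : (natCode x).length ≤ 2 * x + 1 := by
  have h1 := length_listCode_le (c := fun b : Bool => [b]) (l := x.bits) (B := 1) (by simp)
  have h2 : x.bits.length ≤ x := by
    rw [Nat.size_eq_bits_len]
    exact Nat.size_le.2 Nat.lt_two_pow_self
  rw [natCode]
  omega

/-- Each conjunct adds its own code and at most one three-bit tag; the last 3 covers the empty
conjunction `⊤`. -/
theorem length_code_conj_le {B : ℕ} : ∀ l : List Formula, (∀ φ ∈ l, φ.code.length ≤ B) →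
    (Formula.conj l).code.length ≤ l.length * (B + 3) + 3
  | [], _ => by simp [Formula.conj, Formula.code]
  | [φ], h => by
    have := h φ (by simp)
    simp only [Formula.conj, List.length_singleton]
    omega
  | φ :: ψ :: l, h => by
    have h1 := h φ (by simp)
    have h2 := length_code_conj_le (ψ :: l) fun χ hχ => h χ (List.mem_cons_of_mem _ hχ)
    rw [Formula.conj, Formula.code, List.length_cons (a := φ), add_mul]
    simp only [List.length_append, List.length_cons (as := ([] : List Bool)),
      List.length_cons (a := false), List.length_nil, List.length_cons (a := true)] at h2 ⊢
    omega

theorem length_code_disj_le {B : ℕ} : ∀ l : List Formula, (∀ φ ∈ l, φ.code.length ≤ B) →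
    (Formula.disj l).code.length ≤ l.length * (B + 3) + 3
  | [], _ => by simp [Formula.disj, Formula.code]
  | [φ], h => by
    have := h φ (by simp)
    simp only [Formula.disj, List.length_singleton]
    omega
  | φ :: ψ :: l, h => by
    have h1 := h φ (by simp)
    have h2 := length_code_disj_le (ψ :: l) fun χ hχ => h χ (List.mem_cons_of_mem _ hχ)
    rw [Formula.disj, Formula.code, List.length_cons (a := φ), add_mul]
    simp only [List.length_append, List.length_cons (as := ([] : List Bool)),
      List.length_cons (a := false), List.length_nil, List.length_cons (a := true)] at h2 ⊢
    omega

/-- The atom of a literal. -/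
def Literal.atom : Literal → ℕ
  | Literal.pos x => x
  | Literal.neg x => x

theorem Literal.length_code_le (L : Literal) : L.code.length ≤ 2 * L.atom + 10 := by
  cases L with
  | pos x | neg x =>
    have := length_natCode_le x
    simp only [Literal.code, Literal.atom, List.length_cons]
    omega

theorem Literal.length_code_toFormula_le (L : Literal) :
    L.toFormula.code.length ≤ 2 * L.atom + 10 := by
  cases L with
  | pos x | neg x =>
    have := length_natCode_le x
    simp only [Literal.toFormula, Formula.neg, Formula.code, Literal.atom, List.length_append,
      List.length_cons, List.length_nil]
    omega

theorem pair_lt_sq {i j n : ℕ} (hi : i < n) (hj : j < n) : Nat.pair i j < n ^ 2 :=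
  (Nat.pair_lt_max_add_one_sq i j).trans_le
    (Nat.pow_le_pow_left (Nat.succ_le_of_lt (max_lt hi hj)) 2)

/-- A family of clauses whose size is polynomial in `n`. -/
structure SmallClauses (n : ℕ) (𝒞 : List Clause) : Prop where
  length_le : 𝒞.length ≤ 4 * (n + 1) ^ 4
  length_clause_le : ∀ C ∈ 𝒞, C.length ≤ 3 * (n + 1)
  atom_le : ∀ C ∈ 𝒞, ∀ L ∈ C, L.atom ≤ 3 * n ^ 2 + 2

theorem length_distinctPairs_le (m : ℕ) : (distinctPairs m).length ≤ m * m :=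
  (List.length_filter_le _ _).trans (by simp [List.length_product])

theorem length_twoSubsets_le (m : ℕ) : (twoSubsets m).length ≤ m * m :=
  (List.length_filter_le _ _).trans (by simp [List.length_product])

theorem smallClauses_cliqueClauses {k n : ℕ} (hk : k ≤ n) :
    SmallClauses n (cliqueClauses k n) := by
  refine ⟨?_, ?_, ?_⟩
  · have h1 := length_distinctPairs_le n
    have h2 := length_distinctPairs_le k
    have h3 := length_twoSubsets_le n
    simp only [cliqueClauses, List.length_append, List.length_map, List.length_range,
      List.length_product]
    calc k + k * (distinctPairs n).length + (distinctPairs k).length * n +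
          (distinctPairs k).length * (twoSubsets n).length
        ≤ n + n * (n * n) + (n * n) * n + (n * n) * (n * n) := by
          have h2' := h2.trans (Nat.mul_le_mul hk hk)
          gcongr
      _ ≤ 4 * (n + 1) ^ 4 := by ring_nf; nlinarith [Nat.zero_le n]
  · intro C hC
    rcases mem_cliqueClauses.1 hC with ⟨u, hu, rfl⟩ | ⟨u, hu, i, hi, j, hj, hne, rfl⟩ |
      ⟨u, hu, w, hw, hne, i, hi, rfl⟩ | ⟨u, hu, w, hw, hne, i, hi, j, hj, hij, rfl⟩ <;>
    simp only [List.length_map, List.length_range, List.length_cons, List.length_nil] <;> omega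
  · intro C hC
    have hp := fun {i j : ℕ} (hi : i < n) (hj : j < n) => pair_lt_sq hi hj
    rcases mem_cliqueClauses.1 hC with ⟨u, hu, rfl⟩ | ⟨u, hu, i, hi, j, hj, hne, rfl⟩ |
      ⟨u, hu, w, hw, hne, i, hi, rfl⟩ | ⟨u, hu, w, hw, hne, i, hi, j, hj, hij, rfl⟩
    · intro L hL
      obtain ⟨i, hi, rfl⟩ := List.mem_map.1 hL
      have := hp (hu.trans_le hk) (List.mem_range.1 hi)
      simp only [Literal.atom, cliqueAtom]
      omega
    · have h1 := hp (hu.trans_le hk) hi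
      have h2 := hp (hu.trans_le hk) hj
      simp only [List.forall_mem_cons, Literal.atom, cliqueAtom]
      exact ⟨by omega, by omega, by simp⟩
    · have h1 := hp (hu.trans_le hk) hi
      have h2 := hp (hw.trans_le hk) hi
      simp only [List.forall_mem_cons, Literal.atom, cliqueAtom]
      exact ⟨by omega, by omega, by simp⟩
    · have h1 := hp (hu.trans_le hk) hi
      have h2 := hp (hw.trans_le hk) hj
      have h3 := hp hi hj
      simp only [List.forall_mem_cons, Literal.atom, cliqueAtom, edgeAtom]
      exact ⟨by omega, by omega, by omega, by simp⟩

theorem smallClauses_colorClauses {l n : ℕ} (hl : l ≤ n) :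
    SmallClauses n (colorClauses l n) := by
  refine ⟨?_, ?_, ?_⟩
  · have h2 := length_distinctPairs_le l
    have h3 := length_twoSubsets_le n
    simp only [colorClauses, List.length_append, List.length_map, List.length_range,
      List.length_product]
    calc n + n * (distinctPairs l).length + l * (twoSubsets n).length
        ≤ n + n * (n * n) + n * (n * n) := by
          have h2' := h2.trans (Nat.mul_le_mul hl hl)
          gcongr
      _ ≤ 4 * (n + 1) ^ 4 := by ring_nf; nlinarith [Nat.zero_le n]
  · intro C hC
    rcases mem_colorClauses.1 hC with ⟨i, hi, rfl⟩ | ⟨i, hi, c, hc, d, hd, hne, rfl⟩ |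
      ⟨c, hc, i, hi, j, hj, hij, rfl⟩ <;>
    simp only [List.length_map, List.length_range, List.length_cons, List.length_nil] <;> omega
  · intro C hC
    have hp := fun {i j : ℕ} (hi : i < n) (hj : j < n) => pair_lt_sq hi hj
    rcases mem_colorClauses.1 hC with ⟨i, hi, rfl⟩ | ⟨i, hi, c, hc, d, hd, hne, rfl⟩ |
      ⟨c, hc, i, hi, j, hj, hij, rfl⟩
    · intro L hL
      obtain ⟨c, hc, rfl⟩ := List.mem_map.1 hL
      have := hp hi ((List.mem_range.1 hc).trans_le hl)
      simp only [Literal.atom, colorAtom]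
      omega
    · have h1 := hp hi (hc.trans_le hl)
      have h2 := hp hi (hd.trans_le hl)
      simp only [List.forall_mem_cons, Literal.atom, colorAtom]
      exact ⟨by omega, by omega, by simp⟩
    · have h1 := hp hi (hc.trans_le hl)
      have h2 := hp hj (hc.trans_le hl)
      have h3 := hp hi hj
      simp only [List.forall_mem_cons, Literal.atom, colorAtom, edgeAtom]
      exact ⟨by omega, by omega, by omega, by simp⟩

theorem SmallClauses.length_code_cnfFormula_le {n : ℕ} {𝒞 : List Clause}
    (h : SmallClauses n 𝒞) : (cnfFormula 𝒞).code.length ≤ 300 * (n + 1) ^ 7 := by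
  have h1 : ∀ C ∈ 𝒞, (Clause.toFormula C).code.length ≤ 54 * (n + 1) ^ 3 := by
    intro C hC
    -- Here `6 * n ^ 2 + 14 = 2 * (3 * n ^ 2 + 2) + 10`, with the atom bound inserted in the bound
    -- for a literal.
    have h2 := length_code_disj_le (B := 6 * n ^ 2 + 14) (C.map Literal.toFormula) (by
      intro φ hφ
      obtain ⟨L, hL, rfl⟩ := List.mem_map.1 hφ
      have h3 := L.length_code_toFormula_le
      have h4 := h.atom_le C hC L hL
      omega)
    rw [List.length_map] at h2
    calc _ ≤ C.length * (6 * n ^ 2 + 14 + 3) + 3 := h2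
      _ ≤ (3 * (n + 1)) * (6 * n ^ 2 + 14 + 3) + 3 := by
          gcongr
          exact h.length_clause_le C hC
      _ ≤ 54 * (n + 1) ^ 3 := by ring_nf; nlinarith [Nat.zero_le n]
  have h2 := length_code_conj_le (B := 54 * (n + 1) ^ 3) (𝒞.map Clause.toFormula) (by
    intro φ hφ
    obtain ⟨C, hC, rfl⟩ := List.mem_map.1 hφ
    exact h1 C hC)
  rw [List.length_map] at h2
  have h3 : 1 ≤ (n + 1) ^ 3 := Nat.one_le_pow _ _ (by omega)
  have h4 : 1 ≤ (n + 1) ^ 7 := Nat.one_le_pow _ _ (by omega)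
  calc _ ≤ 𝒞.length * (54 * (n + 1) ^ 3 + 3) + 3 := h2
    _ ≤ (4 * (n + 1) ^ 4) * (57 * (n + 1) ^ 3) + 3 := by
        gcongr
        · exact h.length_le
        · omega
    _ = 228 * (n + 1) ^ 7 + 3 := by ring
    _ ≤ 300 * (n + 1) ^ 7 := by omega

theorem length_clausesCode_le {n : ℕ} {𝒞 𝒟 : List Clause} (h𝒞 : SmallClauses n 𝒞)
    (h𝒟 : SmallClauses n 𝒟) : (clausesCode (𝒞 ++ 𝒟)).length ≤ 1000 * (n + 1) ^ 7 := by
  have h1 : ∀ C ∈ 𝒞 ++ 𝒟, (listCode Literal.code C).length ≤ 54 * (n + 1) ^ 3 := by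
    intro C hC
    have hC' : C.length ≤ 3 * (n + 1) ∧ ∀ L ∈ C, L.atom ≤ 3 * n ^ 2 + 2 := by
      rcases List.mem_append.1 hC with hC | hC
      · exact ⟨h𝒞.length_clause_le C hC, h𝒞.atom_le C hC⟩
      · exact ⟨h𝒟.length_clause_le C hC, h𝒟.atom_le C hC⟩
    have h2 := length_listCode_le (c := Literal.code) (l := C) (B := 6 * n ^ 2 + 14) (by
      intro L hL
      have h3 := L.length_code_le
      have h4 := hC'.2 L hL
      omega)
    calc _ ≤ C.length * (6 * n ^ 2 + 14 + 1) + 1 := h2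
      _ ≤ (3 * (n + 1)) * (6 * n ^ 2 + 14 + 1) + 1 := by
          gcongr
          exact hC'.1
      _ ≤ 54 * (n + 1) ^ 3 := by ring_nf; nlinarith [Nat.zero_le n]
  have h2 := length_listCode_le (c := listCode Literal.code) (l := 𝒞 ++ 𝒟) h1
  have h3 : 1 ≤ (n + 1) ^ 3 := Nat.one_le_pow _ _ (by omega)
  have h4 : 1 ≤ (n + 1) ^ 7 := Nat.one_le_pow _ _ (by omega)
  have h5 : (𝒞 ++ 𝒟).length ≤ 8 * (n + 1) ^ 4 := by
    have := h𝒞.length_le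
    have := h𝒟.length_le
    rw [List.length_append]
    omega
  calc _ ≤ (𝒞 ++ 𝒟).length * (54 * (n + 1) ^ 3 + 1) + 1 := h2
    _ ≤ (8 * (n + 1) ^ 4) * (55 * (n + 1) ^ 3) + 1 := by
        gcongr
        omega
    _ = 440 * (n + 1) ^ 7 + 1 := by ring
    _ ≤ 1000 * (n + 1) ^ 7 := by omega

theorem length_code_imp_neg_le {n : ℕ} {𝒞 𝒟 : List Clause} (h𝒞 : SmallClauses n 𝒞)
    (h𝒟 : SmallClauses n 𝒟) :
    (((cnfFormula 𝒞).imp (cnfFormula 𝒟).neg).code).length ≤ 1000 * (n + 1) ^ 7 := by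
  have h1 := h𝒞.length_code_cnfFormula_le
  have h2 := h𝒟.length_code_cnfFormula_le
  have h4 : 1 ≤ (n + 1) ^ 7 := Nat.one_le_pow _ _ (by omega)
  simp only [Formula.neg, Formula.code, List.length_append, List.length_cons, List.length_nil]
  omega

/-! ### Failure of polynomial boundedness -/

theorem polynomial_eval_monotone (p : Polynomial ℕ) : Monotone fun x => p.eval x := by
  intro x y hxy
  simp only [Polynomial.eval_eq_sum_range]
  gcongr

/-- In the variable `y = d * n^(1/6)` with `d = c * log 2`, the right side is `exp y` and the left
side is the polynomial `p((y/d)^6)`, whose quotient by `exp y` tends to 0. -/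
theorem eventually_eval_lt_two_rpow (p : Polynomial ℕ) {c : ℝ} (hc : 0 < c) :
    ∃ N : ℕ, ∀ n : ℕ, N ≤ n → ((p.eval n : ℕ) : ℝ) < (2 : ℝ) ^ (c * (n : ℝ) ^ (1 / 6 : ℝ)) := by
  have hd : 0 < Real.log 2 * c := mul_pos (Real.log_pos (by norm_num)) hc
  set d := Real.log 2 * c with hd'
  let r : Polynomial ℝ :=
    (p.map (Nat.castRingHom ℝ)).comp ((Polynomial.C d⁻¹ * Polynomial.X) ^ 6)
  have h1 : Filter.Tendsto (fun n : ℕ => d * (n : ℝ) ^ (1 / 6 : ℝ)) Filter.atTop Filter.atTop :=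
    ((tendsto_rpow_atTop (by norm_num)).comp tendsto_natCast_atTop_atTop).const_mul_atTop hd
  have h2 := ((Polynomial.tendsto_div_exp_atTop r).comp h1).eventually_lt_const
    (show (0 : ℝ) < 1 by norm_num)
  obtain ⟨N, hN⟩ := Filter.eventually_atTop.1 h2
  refine ⟨N, fun n hn => ?_⟩
  have h3 := hN n hn
  have h4 : r.eval (d * (n : ℝ) ^ (1 / 6 : ℝ)) = ((p.eval n : ℕ) : ℝ) := by
    have h5 : ((n : ℝ) ^ (1 / 6 : ℝ)) ^ 6 = n := by
      rw [← Real.rpow_natCast, ← Real.rpow_mul (by positivity)]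
      norm_num
    simp only [r, Polynomial.eval_comp, Polynomial.eval_pow, Polynomial.eval_mul,
      Polynomial.eval_C, Polynomial.eval_X]
    rw [inv_mul_cancel_left₀ hd.ne', h5]
    simp
  rw [Function.comp_apply, h4, div_lt_one (Real.exp_pos _)] at h3
  rwa [Real.rpow_def_of_pos (by norm_num), ← mul_assoc]

/-- A proof system is not polynomially bounded if some family of short strings requires long
proofs. -/
theorem not_pBounded {L : Set (List Bool)} {P : List Bool → List Bool → Prop}
    (w : ℕ → List Bool) {c : ℝ} (hc : 0 < c) {N : ℕ} (hL : ∀ n, N ≤ n → w n ∈ L)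
    (hw : ∀ n, N ≤ n → (w n).length ≤ 1000 * (n + 1) ^ 7)
    (hP : ∀ n, N ≤ n → ∀ u, P u (w n) → (2 : ℝ) ^ (c * (n : ℝ) ^ (1 / 6 : ℝ)) ≤ u.length) :
    ¬ PBounded L P := by
  rintro ⟨p, hp⟩
  obtain ⟨M, hM⟩ := eventually_eval_lt_two_rpow
    (p.comp (1000 * (Polynomial.X + 1) ^ 7)) hc
  have hN := le_max_left N M
  obtain ⟨u, hu, hup⟩ := hp _ (hL _ hN)
  have h1 := hM _ (le_max_right N M)
  have h2 := hP _ hN u hu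
  have h3 := hup.trans (polynomial_eval_monotone p (hw _ hN))
  have h4 : (p.comp (1000 * (Polynomial.X + 1) ^ 7)).eval (max N M) =
      p.eval (1000 * (max N M + 1) ^ 7) := by
    rw [Polynomial.eval_comp]
    congr 1
    simp
  rw [h4] at h1
  have h5 : ((u.length : ℕ) : ℝ) ≤ (p.eval (1000 * (max N M + 1) ^ 7) : ℕ) := by exact_mod_cast h3
  linarith

/-- With `y = n^(1/3)` there are `⌊y⌋` colors and the clique has size `⌊y²⌋`; the bound `8 ≤ n`
means `2 ≤ y`, hence `y + 1 ≤ y²`. -/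
theorem sixth_parameters {n : ℕ} (hn : 8 ≤ n) :
    ⌊(n : ℝ) ^ (2 / 3 : ℝ)⌋₊ ≤ n ∧ ⌊(n : ℝ) ^ (2 / 3 - 2 * (1 / 6) : ℝ)⌋₊ ≤ n ∧
      ⌊(n : ℝ) ^ (2 / 3 - 2 * (1 / 6) : ℝ)⌋₊ < ⌊(n : ℝ) ^ (2 / 3 : ℝ)⌋₊ := by
  have hn8 : (8 : ℝ) ≤ n := by exact_mod_cast hn
  have hle : ∀ {δ : ℝ}, δ ≤ 1 → ⌊(n : ℝ) ^ δ⌋₊ ≤ n := by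
    intro δ hδ
    refine Nat.floor_le_of_le ?_
    calc (n : ℝ) ^ δ ≤ (n : ℝ) ^ (1 : ℝ) :=
          Real.rpow_le_rpow_of_exponent_le (by linarith) hδ
      _ = n := Real.rpow_one _
  refine ⟨hle (by norm_num), hle (by norm_num), ?_⟩
  set y := (n : ℝ) ^ (2 / 3 - 2 * (1 / 6) : ℝ) with hy
  have h1 : (n : ℝ) ^ (2 / 3 : ℝ) = y * y := by
    rw [hy, ← Real.rpow_add (by linarith)]
    norm_num
  have h2 : 2 ≤ y := by
    have : (8 : ℝ) ^ (2 / 3 - 2 * (1 / 6) : ℝ) = 2 := by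
      rw [show (8 : ℝ) = 2 ^ (3 : ℝ) by norm_num, ← Real.rpow_mul (by norm_num)]
      norm_num
    rw [← this]
    exact Real.rpow_le_rpow (by norm_num) hn8 (by norm_num)
  rw [h1, Nat.lt_iff_add_one_le]
  apply Nat.le_floor
  push_cast
  have h3 := Nat.floor_le (show 0 ≤ y by linarith)
  nlinarith

theorem valid_cliqueColorFormula {ε : ℝ} {n : ℕ}
    (h : ⌊(n : ℝ) ^ (2 / 3 - 2 * ε : ℝ)⌋₊ < ⌊(n : ℝ) ^ (2 / 3 : ℝ)⌋₊) :
    (cliqueColorFormula ε n).Valid := by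
  intro v
  by_contra hv
  simp only [cliqueColorFormula, Formula.neg, Formula.eval, Bool.or_false, Bool.or_eq_true,
    Bool.not_eq_true', not_or, Bool.not_eq_false] at hv
  exact not_holds_clique_and_color h v ((eval_cnfFormula _ _).1 hv.1)
    ((eval_cnfFormula _ _).1 hv.2)

theorem unsat_clique_append_color {ε : ℝ} {n : ℕ}
    (h : ⌊(n : ℝ) ^ (2 / 3 - 2 * ε : ℝ)⌋₊ < ⌊(n : ℝ) ^ (2 / 3 : ℝ)⌋₊) :
    Unsat (Clique n ++ Color ε n) := by
  rintro ⟨v, hv⟩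
  exact not_holds_clique_and_color h v (fun C hC => hv C (List.mem_append_left _ hC))
    fun C hC => hv C (List.mem_append_right _ hC)

/-- The choice `ε = 1/6` turns `1/3 - ε` into the exponent `1/6` built into `not_pBounded`. -/
theorem not_pBounded_lkMinus : ¬ PBounded CPC LKMinus := by
  obtain ⟨c, hc, N, h⟩ := exists_lkMinus_lower_bound (ε := 1 / 6) (by norm_num) (by norm_num)
  rw [show (1 / 3 - 1 / 6 : ℝ) = 1 / 6 by norm_num] at h
  refine not_pBounded (fun n => (cliqueColorFormula (1 / 6) n).code) hc (N := max N 8)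
    ?_ ?_ fun n hn => h n (le_of_max_le_left hn)
  · intro n hn
    exact ⟨_, valid_cliqueColorFormula (sixth_parameters (le_of_max_le_right hn)).2.2, rfl⟩
  · intro n hn
    obtain ⟨hk, hl, -⟩ := sixth_parameters (le_of_max_le_right hn)
    exact length_code_imp_neg_le (smallClauses_cliqueClauses hk) (smallClauses_colorClauses hl)

theorem not_pBounded_resolution : ¬ PBounded UNSAT Resolution := by
  obtain ⟨c, hc, N, h⟩ := exists_resolution_lower_bound (ε := 1 / 6) (by norm_num) (by norm_num)
  rw [show (1 / 3 - 1 / 6 : ℝ) = 1 / 6 by norm_num] at h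
  refine not_pBounded (fun n => clausesCode (Clique n ++ Color (1 / 6) n)) hc (N := max N 8)
    ?_ ?_ fun n hn => h n (le_of_max_le_left hn)
  · intro n hn
    exact ⟨_, unsat_clique_append_color (sixth_parameters (le_of_max_le_right hn)).2.2, rfl⟩
  · intro n hn
    obtain ⟨hk, hl, -⟩ := sixth_parameters (le_of_max_le_right hn)
    exact length_clausesCode_le (smallClauses_cliqueClauses hk) (smallClauses_colorClauses hl)

end ProofComplexity

open ProofComplexity
theorem mainTheorem10 :
    (∀ ε : ℝ, 0 < ε → ε < 1 / 3 →
      (∃ c : ℝ, 0 < c ∧ ∃ N : ℕ, ∀ n : ℕ, N ≤ n →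
        ∀ u : List Bool, LKMinus u (cliqueColorFormula ε n).code →
          (2 : ℝ) ^ (c * (n : ℝ) ^ (1 / 3 - ε)) ≤ (u.length : ℝ)) ∧
      (∃ c : ℝ, 0 < c ∧ ∃ N : ℕ, ∀ n : ℕ, N ≤ n →
        ∀ u : List Bool, Resolution u (clausesCode (Clique n ++ Color ε n)) →
          (2 : ℝ) ^ (c * (n : ℝ) ^ (1 / 3 - ε)) ≤ (u.length : ℝ))) ∧
    ¬ PBounded CPC LKMinus ∧
    ¬ PBounded UNSAT Resolution := by
  exact ⟨fun ε h0 h1 => ⟨exists_lkMinus_lower_bound h0 h1, exists_resolution_lower_bound h0 h1⟩,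
    not_pBounded_lkMinus, not_pBounded_resolution⟩
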